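/- Let $K$ be a field and let $G$ be a finite simple graph with vertex set $V$. Its edge ideal is $I(G) = (x_ix_j : ij \in E(G)) \subset S = K[x_u : u \in V]$. For a nonzero monomial ideal $I$ of $S$, with minimal $\mathbb{Z}^V$-graded free resolution $0 \to F_p \to \cdots \to F_1 \to F_0 \to I \to 0$, $F_i = \bigoplus_{\sigma \in \mathbb{Z}^V} S(-\sigma)^{\beta_{i,\sigma}(I)}$, the Castelnuovo-Mumford regularity is $$\mathrm{reg}(I) := \max\{|\sigma| - i : \beta_{i,\sigma}(I) \neq 0\},\qquad |\sigma| = \sum_{u\in V}\sigma_u,$$ and for the zero ideal (the edge ideal of a graph without edges) one sets $\mathrm{reg}(0) := \mathrm{reg}(S/0) + 1 = 1$. Let $v \in V$, and let $G \setminus v$ be the graph obtained from $G$ by deleting $v$ and all edges at $v$, so that $I(G\setminus v)$ is an ideal of $K[x_u : u \in V\setminus\{v\}]$. Then both regularities are well defined (they exist and do not depend on the choice of the minimal free resolution), and $$|\mathrm{reg}(I(G)) - \mathrm{reg}(I(G \setminus v))| \leq 1.$$ -/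

import Mathlib

namespace EdgeIdealReg

open MvPolynomial

/-- The edge ideal `I(G) = (x_i x_j : ij is an edge of G)` in the polynomial ring
`K[x_v : v ∈ V]`. -/
noncomputable def edgeIdeal (K : Type*) [Field K] {V : Type*} (G : SimpleGraph V) : Ideal (MvPolynomial V K) :=
  Ideal.span {p | ∃ i j : V, G.Adj i j ∧ p = X i * X j}

/-- The weights of the fine grading by `V →₀ ℤ` (that is, by `ℤⁿ`): the variable `x_v` has degree
the `v`-th unit vector. A polynomial is weighted homogeneous of degree `σ` for these weights iff
it is a scalar multiple of the monomial with exponent vector `σ` (and it is `0` if `σ` has a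
negative coordinate). -/
noncomputable def fineWeight (V : Type*) : V → (V →₀ ℤ) := fun v => Finsupp.single v 1

/-- A minimal `ℤⁿ`-graded free resolution
`0 ⟶ F_p ⟶ ⋯ ⟶ F_1 ⟶ F_0 ⟶ I ⟶ 0` of an ideal `I` of `S = K[x_v : v ∈ V]`, viewed as an
`S`-module. Here `F_i = ⨁_b S(-deg i b)` is free on `rank i` homogeneous basis elements, the `b`-th
one having multidegree `deg i b`; the maps are homogeneous of degree `0`. -/
structure MinimalFreeResolution {K : Type*} [Field K] {V : Type*}
    (I : Ideal (MvPolynomial V K)) where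
  /-- the rank of `F_i` -/
  rank : ℕ → ℕ
  /-- the multidegree of the `b`-th basis element of `F_i` -/
  deg : (i : ℕ) → Fin (rank i) → (V →₀ ℤ)
  /-- the differential `F_{i+1} ⟶ F_i` -/
  d : (i : ℕ) →
    (Fin (rank (i + 1)) → MvPolynomial V K) →ₗ[MvPolynomial V K] (Fin (rank i) → MvPolynomial V K)
  /-- the augmentation `F_0 ⟶ I` -/
  aug : (Fin (rank 0) → MvPolynomial V K) →ₗ[MvPolynomial V K] I
  /-- the resolution has finite length -/
  finite_length : ∃ p : ℕ, ∀ i, p < i → rank i = 0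
  /-- the differentials preserve multidegrees: the `(a, b)` entry of the matrix of `F_{i+1} ⟶ F_i`
  is homogeneous of degree `deg (i + 1) b - deg i a` -/
  d_homogeneous : ∀ (i : ℕ) (b : Fin (rank (i + 1))) (a : Fin (rank i)),
    IsWeightedHomogeneous (fineWeight V) (d i (Pi.single b 1) a) (deg (i + 1) b - deg i a)
  /-- the augmentation preserves multidegrees -/
  aug_homogeneous : ∀ b : Fin (rank 0),
    IsWeightedHomogeneous (fineWeight V) (aug (Pi.single b 1) : MvPolynomial V K) (deg 0 b)
  /-- exactness at `I` -/
  aug_surjective : Function.Surjective aug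
  /-- exactness at `F_0` -/
  exact_zero : Function.Exact (d 0) aug
  /-- exactness at `F_{i+1}` -/
  exact_succ : ∀ i : ℕ, Function.Exact (d (i + 1)) (d i)
  /-- minimality: the entries of the differentials lie in the ideal `(x_v : v ∈ V)` -/
  minimal : ∀ (i : ℕ) (b : Fin (rank (i + 1))) (a : Fin (rank i)),
    constantCoeff (d i (Pi.single b 1) a) = 0

/-- The multigraded Betti number `β_{i,σ}`: the number of summands `S(-σ)` of `F_i`. -/
noncomputable def MinimalFreeResolution.betti {K : Type*} [Field K] {V : Type*}
    {I : Ideal (MvPolynomial V K)} (F : MinimalFreeResolution I) (i : ℕ) (σ : V →₀ ℤ) : ℕ :=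
  Nat.card {b : Fin (F.rank i) // F.deg i b = σ}

/-- `r` is the Castelnuovo-Mumford regularity of the ideal `I`:
`r = max {|σ| - i : β_{i,σ}(I) ≠ 0}` if `I ≠ 0`. The maximum is over the empty set for `I = 0`;
the usual convention `reg I = reg (S/I) + 1` gives the value `1` in that case. -/
def IsRegularity {K : Type*} [Field K] {V : Type*} (I : Ideal (MvPolynomial V K)) (r : ℤ) : Prop :=
  (I = ⊥ ∧ r = 1) ∨
  (I ≠ ⊥ ∧ ∃ F : MinimalFreeResolution I,
    IsGreatest {x : ℤ | ∃ (i : ℕ) (σ : V →₀ ℤ), F.betti i σ ≠ 0 ∧ x = Finsupp.degree σ - (i : ℤ)} r)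

end EdgeIdealReg

/-!
The argument works degree by degree. In a `ℤⁿ`-graded free complex every matrix entry is a scalar
times a monomial, and the degrees of the basis elements determine the monomial. So the complex is a
matrix of scalars together with a degree for each basis element, and it is exact if and only if, for
each degree `τ`, the part spanned by the basis elements of degree `≤ τ` is an exact complex of vector
spaces. A resolution of a monomial ideal becomes a `PosetResolution` of its exponent set `U`, an
upper set in the poset of degrees.

For these resolutions the facts needed are linear algebra over `K`.
* If `F` is minimal, then every pair `(i, σ)` that occurs in `F` occurs in every other resolution
  (`PosetResolution.exists_lev_eq_deg_eq_of_minimal`), since comparison maps exist and are unique up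
  to homotopy. Hence the regularity is well defined, and it is the least `r` such that some
  resolution, minimal or not, satisfies `|σ| - i ≤ r` throughout
  (`IsMonomialIdeal.isLeast_of_isRegularity`).
* The mapping cone gives a resolution of `U ∪ W` from resolutions of `U`, `W` and `U ∩ W`
  (`HasResolution.union`). By induction on the number of generators every finitely generated `U` has
  a finite resolution, and Gaussian elimination makes it minimal (`PosetResolution.exists_minimal`).
* Keeping only the basis elements with suitable degrees, and changing these degrees, yields
  resolutions of related ideals (`HasResolution.transport`).

Restricting a resolution of `I(G)` to the degrees that do not involve `v` gives
`reg I(G \ v) ≤ reg I(G)`. For the other bound write `I(G) = J + x_v L`, where `J` is generated by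
`I(G \ v)` and `L` by `J` and the neighbours of `v`. As `J ∩ x_v L = x_v J`, the mapping cone yields
`reg I(G) ≤ max (reg J) (reg L + 1)`, and adding variables to an ideal does not raise the regularity
beyond `max (reg J) 1`, so that `reg L ≤ reg J`. Together these give `reg I(G) ≤ reg I(G \ v) + 1`.
The convention `reg 0 = 1` is what makes this correct for `J = 0`.
-/

namespace EdgeIdealReg

/-! ### Coordinate subspaces -/

/-- The coordinate subspace of `B → K` of the functions that vanish outside `s`. -/
def suppIn (K : Type*) [Field K] {B : Type*} (s : Set B) : Submodule K (B → K) where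
  carrier := {x | ∀ b, x b ≠ 0 → b ∈ s}
  zero_mem' := fun _ h => absurd rfl h
  add_mem' := by
    intro x y hx hy b hb
    by_cases h : x b = 0
    · refine hy b fun h' => hb ?_
      simp [h, h']
    · exact hx b h
  smul_mem' := by
    intro c x hx b hb
    refine hx b fun h => hb ?_
    simp [h]

section SuppIn

variable {K : Type*} [Field K] {B : Type*} {M : Type*} [AddCommGroup M] [Module K M]

theorem suppIn_mono {s t : Set B} (h : s ⊆ t) : suppIn K s ≤ suppIn K t :=
  fun _ hx b hb => h (hx b hb)

theorem single_mem_suppIn [DecidableEq B] {s : Set B} {b : B} (h : b ∈ s) (c : K) :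
    Pi.single b c ∈ suppIn K s := by
  intro a ha
  by_cases hab : a = b
  · exact hab ▸ h
  · simp [hab] at ha

theorem map_mem_of_single_mem [Fintype B] [DecidableEq B] {s : Set B} {x : B → K}
    (hx : x ∈ suppIn K s) (L : (B → K) →ₗ[K] M) (N : Submodule K M)
    (h : ∀ b ∈ s, L (Pi.single b 1) ∈ N) : L x ∈ N := by
  rw [L.pi_apply_eq_sum_univ x]
  refine N.sum_mem fun b _ => ?_
  by_cases hb : x b = 0
  · simp [hb]
  · refine N.smul_mem _ ?_
    convert h b (hx b hb) using 2
    ext a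
    simp [Pi.single_apply, eq_comm]

theorem map_eq_of_single_eq [Fintype B] [DecidableEq B] {s : Set B} {x : B → K}
    (hx : x ∈ suppIn K s) (L L' : (B → K) →ₗ[K] M)
    (h : ∀ b ∈ s, L (Pi.single b 1) = L' (Pi.single b 1)) : L x = L' x := by
  have := map_mem_of_single_mem hx (L - L') ⊥ fun b hb => by simp [h b hb]
  simpa [sub_eq_zero] using this

theorem map_eq_zero_of_single [Fintype B] [DecidableEq B] {s : Set B} {x : B → K}
    (hx : x ∈ suppIn K s) (L : (B → K) →ₗ[K] M)
    (h : ∀ b ∈ s, L (Pi.single b 1) = 0) : L x = 0 :=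
  map_eq_of_single_eq hx L 0 (by simpa using h)

theorem exists_linearMap_single [Fintype B] [DecidableEq B] (y : B → M) :
    ∃ f : (B → K) →ₗ[K] M, ∀ b, f (Pi.single b 1) = y b :=
  ⟨(Pi.basisFun K B).constr K y, fun b => by
    rw [← Pi.basisFun_apply, Module.Basis.constr_basis]⟩

end SuppIn

/-! ### Free resolutions over a poset -/

/-- A finite free resolution, over the poset `P`, of the functor that is `K` on the upper set `U`
and `0` elsewhere. For `P = ℤⁿ` this encodes a `ℤⁿ`-graded free resolution of the monomial ideal
with exponent set `U`: homogeneity makes every matrix entry a scalar times a monomial which the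
degrees determine, so only the scalars are recorded. The basis elements of all homological degrees
`lev` form one type `B`, and `D` is the total differential. The strand in degree `τ` is spanned by
the basis elements of degree `≤ τ`, and exactness is required of all strands. -/
structure PosetResolution (K : Type*) [Field K] {P : Type*} [PartialOrder P] (U : Set P) where
  /-- the set of all basis elements -/
  B : Type
  [fintype : Fintype B]
  [decEq : DecidableEq B]
  /-- the homological degree -/
  lev : B → ℕ
  /-- the degree in the poset -/
  deg : B → P
  /-- the matrix of scalars of the differential -/
  D : (B → K) →ₗ[K] (B → K)
  /-- the augmentation -/
  ε : (B → K) →ₗ[K] K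
  upper : IsUpperSet U
  D_single : ∀ b a, D (Pi.single b 1) a ≠ 0 → lev a + 1 = lev b ∧ deg a ≤ deg b
  ε_single : ∀ b, ε (Pi.single b 1) ≠ 0 → lev b = 0 ∧ deg b ∈ U
  D_D : ∀ x, D (D x) = 0
  ε_D : ∀ x, ε (D x) = 0
  exact : ∀ τ, ∀ x ∈ suppIn K {b | deg b ≤ τ}, D x = 0 → ε x = 0 →
    ∃ y ∈ suppIn K {b | deg b ≤ τ}, D y = x
  surj : ∀ τ ∈ U, ∃ x ∈ suppIn K {b | lev b = 0 ∧ deg b ≤ τ}, ε x = 1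

namespace PosetResolution

attribute [instance] PosetResolution.fintype PosetResolution.decEq

variable {K : Type*} [Field K] {P : Type*} [PartialOrder P] {U W : Set P}

/-- The part of the strand in degree `τ` that lies in homological degree `i`. -/
def cell (F : PosetResolution K U) (i : ℕ) (τ : P) : Submodule K (F.B → K) :=
  suppIn K {b | F.lev b = i ∧ F.deg b ≤ τ}

/-- A resolution is minimal if its differential has no nonzero scalar entry between basis elements
of the same degree. -/
def Minimal (F : PosetResolution K U) : Prop :=
  ∀ a b, F.D (Pi.single b 1) a ≠ 0 → F.deg a ≠ F.deg b

variable (F : PosetResolution K U)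

theorem single_mem_cell (b : F.B) : Pi.single b 1 ∈ F.cell (F.lev b) (F.deg b) := by
  refine single_mem_suppIn ?_ 1
  exact ⟨rfl, le_rfl⟩

theorem cell_mono {i : ℕ} {σ τ : P} (h : σ ≤ τ) : F.cell i σ ≤ F.cell i τ :=
  suppIn_mono fun _ hb => ⟨hb.1, hb.2.trans h⟩

theorem D_mem {τ : P} {x : F.B → K} (hx : x ∈ suppIn K {b | F.deg b ≤ τ}) :
    F.D x ∈ suppIn K {b | F.deg b ≤ τ} :=
  map_mem_of_single_mem hx _ _ fun _ hb _ ha => ((F.D_single _ _ ha).2.trans hb)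

theorem D_single_mem (b : F.B) {n : ℕ} (h : F.lev b = n + 1) :
    F.D (Pi.single b 1) ∈ F.cell n (F.deg b) := by
  intro a ha
  have := F.D_single _ _ ha
  exact ⟨by omega, this.2⟩

theorem D_single_eq_zero (b : F.B) (h : F.lev b = 0) : F.D (Pi.single b 1) = 0 := by
  ext a
  by_contra ha
  have := (F.D_single _ _ ha).1
  omega

theorem D_mem_cell {n : ℕ} {τ : P} {x : F.B → K} (hx : x ∈ F.cell (n + 1) τ) :
    F.D x ∈ F.cell n τ :=
  map_mem_of_single_mem hx _ _ fun b hb => F.cell_mono hb.2 (F.D_single_mem b hb.1)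

theorem D_eq_zero_of_mem_cell {τ : P} {x : F.B → K} (hx : x ∈ F.cell 0 τ) : F.D x = 0 :=
  map_eq_zero_of_single hx _ fun b hb => F.D_single_eq_zero b hb.1

theorem ε_single_eq_zero (b : F.B) (h : F.lev b ≠ 0) : F.ε (Pi.single b 1) = 0 := by
  by_contra hb
  exact h (F.ε_single b hb).1

theorem ε_eq_zero_of_mem_cell {n : ℕ} {τ : P} {x : F.B → K} (hx : x ∈ F.cell (n + 1) τ) :
    F.ε x = 0 :=
  map_eq_zero_of_single hx _ fun b hb => F.ε_single_eq_zero b (by have := hb.1; omega)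

theorem mem_of_ε_ne_zero {τ : P} {x : F.B → K} (hx : x ∈ suppIn K {b | F.deg b ≤ τ})
    (h : F.ε x ≠ 0) : τ ∈ U := by
  by_contra hτ
  refine h (map_eq_zero_of_single hx _ fun b hb => ?_)
  by_contra hb'
  exact hτ (F.upper hb (F.ε_single b hb').2)

/-- Exactness of strands in each homological degree: the component of the right homological degree
of a preimage is again a preimage. -/
theorem exact_cell {i : ℕ} {τ : P} {x : F.B → K} (hx : x ∈ F.cell i τ) (hD : F.D x = 0)
    (hε : F.ε x = 0) : ∃ y ∈ F.cell (i + 1) τ, F.D y = x := by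
  obtain ⟨y, hy, rfl⟩ := F.exact τ x (suppIn_mono (fun _ hb => hb.2) hx) hD hε
  classical
  set y₁ : F.B → K := fun b => if F.lev b = i + 1 then y b else 0 with hy₁
  have h₁ : y₁ ∈ F.cell (i + 1) τ := by
    intro b hb
    by_cases h : F.lev b = i + 1
    · exact ⟨h, hy b (by simpa [hy₁, h] using hb)⟩
    · simp [hy₁, h] at hb
  have h₂ : y - y₁ ∈ suppIn K {b | F.lev b ≠ i + 1} := by
    intro b hb h
    simp [hy₁, h] at hb
  have h₃ : F.D (y - y₁) ∈ suppIn K {b | F.lev b ≠ i} :=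
    map_mem_of_single_mem h₂ _ _ fun b hb a ha h =>
      hb (by have := (F.D_single _ _ ha).1; omega)
  refine ⟨y₁, h₁, ?_⟩
  have h₄ : F.D y - F.D y₁ ∈ F.cell i τ := sub_mem hx (F.D_mem_cell h₁)
  rw [map_sub] at h₃
  refine (sub_eq_zero.1 ?_).symm
  ext a
  by_contra ha
  exact h₃ a ha (h₄ a ha).1

theorem exists_lev_lt : ∃ n, ∀ b, F.lev b < n := by
  refine ⟨Finset.univ.sup F.lev + 1, fun b => ?_⟩
  exact Nat.lt_succ_of_le (Finset.le_sup (Finset.mem_univ b))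

/-! ### Comparison of resolutions -/

/-- The comparison map: the inclusion of `U` in `W` lifts to a homogeneous map of resolutions. -/
theorem exists_lift (G : PosetResolution K W) (hUW : U ⊆ W) :
    ∃ f : (F.B → K) →ₗ[K] (G.B → K), (∀ b, f (Pi.single b 1) ∈ G.cell (F.lev b) (F.deg b)) ∧
      (∀ x, f (F.D x) = G.D (f x)) ∧ ∀ x, G.ε (f x) = F.ε x := by
  -- It suffices to construct maps compatible with the differential below a homological degree `n`.
  have key : ∀ n : ℕ, ∃ f : (F.B → K) →ₗ[K] (G.B → K),
      (∀ b, f (Pi.single b 1) ∈ G.cell (F.lev b) (F.deg b)) ∧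
      ∀ b, F.lev b < n → f (F.D (Pi.single b 1)) = G.D (f (Pi.single b 1)) ∧
        G.ε (f (Pi.single b 1)) = F.ε (Pi.single b 1) := by
    intro n
    induction n with
    | zero => exact ⟨0, fun b => by simp, fun b hb => absurd hb (Nat.not_lt_zero _)⟩
    | succ n ih =>
      obtain ⟨f, hf, hfn⟩ := ih
      have hy : ∀ b : F.B, ∃ y ∈ G.cell (F.lev b) (F.deg b), (F.lev b ≠ n → y = f (Pi.single b 1)) ∧
          (F.lev b = n → f (F.D (Pi.single b 1)) = G.D y ∧ G.ε y = F.ε (Pi.single b 1)) := by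
        intro b
        by_cases hb : F.lev b = n
        · obtain rfl | ⟨m, rfl⟩ : n = 0 ∨ ∃ m, n = m + 1 := by
            cases n <;> simp
          · by_cases hε : F.ε (Pi.single b 1) = 0
            · exact ⟨0, zero_mem _, by simp [hb], fun _ => by
                simp [hε, F.D_single_eq_zero b hb]⟩
            · obtain ⟨x, hx, hx1⟩ := G.surj (F.deg b) (hUW (F.ε_single b hε).2)
              have hx' : x ∈ G.cell 0 (F.deg b) := hx
              refine ⟨F.ε (Pi.single b 1) • x, ?_, by simp [hb], fun _ => ⟨?_, ?_⟩⟩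
              · rw [hb]
                exact Submodule.smul_mem _ _ hx'
              · simp [F.D_single_eq_zero b hb, G.D_eq_zero_of_mem_cell hx']
              · simp [hx1]
          · have hd := F.D_single_mem b hb
            have hc : f (F.D (Pi.single b 1)) ∈ G.cell m (F.deg b) :=
              map_mem_of_single_mem hd _ _ fun a ha => by
                have := hf a
                rw [ha.1] at this
                exact G.cell_mono ha.2 this
            have h0 : G.D (f (F.D (Pi.single b 1))) = 0 := by
              have : f (F.D (F.D (Pi.single b 1))) = G.D (f (F.D (Pi.single b 1))) :=
                map_eq_of_single_eq hd (f ∘ₗ F.D) (G.D ∘ₗ f) fun a ha =>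
                  (hfn a (by have := ha.1; omega)).1
              rw [← this, F.D_D, map_zero]
            have h1 : G.ε (f (F.D (Pi.single b 1))) = 0 := by
              have : G.ε (f (F.D (Pi.single b 1))) = F.ε (F.D (Pi.single b 1)) :=
                map_eq_of_single_eq hd (G.ε ∘ₗ f) F.ε fun a ha =>
                  (hfn a (by have := ha.1; omega)).2
              rw [this, F.ε_D]
            obtain ⟨y, hy, hyD⟩ := G.exact_cell hc h0 h1
            refine ⟨y, by rw [hb]; exact hy, by simp [hb], fun _ => ⟨hyD.symm, ?_⟩⟩
            rw [G.ε_eq_zero_of_mem_cell hy, F.ε_single_eq_zero b (by omega)]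
        · exact ⟨f (Pi.single b 1), hf b, fun _ => rfl, fun h => absurd h hb⟩
      choose y hyc hyne hyeq using hy
      obtain ⟨f', hf'⟩ := exists_linearMap_single (K := K) y
      refine ⟨f', fun b => by rw [hf']; exact hyc b, fun b hb => ?_⟩
      have hfD : f' (F.D (Pi.single b 1)) = f (F.D (Pi.single b 1)) := by
        refine map_eq_of_single_eq (s := {a | F.lev a ≠ n}) (fun a ha => ?_) f' f fun a ha => ?_
        · have := (F.D_single _ _ ha).1
          change F.lev a ≠ n
          omega
        · rw [hf', hyne a ha]
      rw [hfD, hf']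
      by_cases hbn : F.lev b = n
      · exact hyeq b hbn
      · rw [hyne b hbn]
        exact hfn b (by omega)
  obtain ⟨n, hn⟩ := F.exists_lev_lt
  obtain ⟨f, hf, hfn⟩ := key n
  refine ⟨f, hf, fun x => ?_, fun x => ?_⟩
  · exact map_eq_of_single_eq (s := Set.univ) (fun _ _ => trivial) (f ∘ₗ F.D) (G.D ∘ₗ f)
      fun b _ => (hfn b (hn b)).1
  · exact map_eq_of_single_eq (s := Set.univ) (fun _ _ => trivial) (G.ε ∘ₗ f) F.ε
      fun b _ => (hfn b (hn b)).2

/-- A homogeneous map of resolutions that vanishes on the resolved functor is null-homotopic. -/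
theorem exists_homotopy (G : PosetResolution K W) (ψ : (F.B → K) →ₗ[K] (G.B → K))
    (hψ : ∀ b, ψ (Pi.single b 1) ∈ G.cell (F.lev b) (F.deg b))
    (hψD : ∀ x, ψ (F.D x) = G.D (ψ x)) (hψε : ∀ x, G.ε (ψ x) = 0) :
    ∃ s : (F.B → K) →ₗ[K] (G.B → K),
      (∀ b, s (Pi.single b 1) ∈ G.cell (F.lev b + 1) (F.deg b)) ∧
      ∀ x, ψ x = G.D (s x) + s (F.D x) := by
  have key : ∀ n : ℕ, ∃ s : (F.B → K) →ₗ[K] (G.B → K),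
      (∀ b, s (Pi.single b 1) ∈ G.cell (F.lev b + 1) (F.deg b)) ∧
      ∀ b, F.lev b < n →
        ψ (Pi.single b 1) = G.D (s (Pi.single b 1)) + s (F.D (Pi.single b 1)) := by
    intro n
    induction n with
    | zero => exact ⟨0, fun b => by simp, fun b hb => absurd hb (Nat.not_lt_zero _)⟩
    | succ n ih =>
      obtain ⟨s, hs, hsn⟩ := ih
      have hy : ∀ b : F.B, ∃ y ∈ G.cell (F.lev b + 1) (F.deg b),
          (F.lev b ≠ n → y = s (Pi.single b 1)) ∧
          (F.lev b = n → ψ (Pi.single b 1) = G.D y + s (F.D (Pi.single b 1))) := by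
        intro b
        by_cases hb : F.lev b = n
        · obtain ⟨hc, h0, h1⟩ : ψ (Pi.single b 1) - s (F.D (Pi.single b 1)) ∈
              G.cell (F.lev b) (F.deg b) ∧
              G.D (ψ (Pi.single b 1) - s (F.D (Pi.single b 1))) = 0 ∧
              G.ε (ψ (Pi.single b 1) - s (F.D (Pi.single b 1))) = 0 := by
            obtain rfl | ⟨m, rfl⟩ : n = 0 ∨ ∃ m, n = m + 1 := by
              cases n <;> simp
            · have := hψ b
              rw [F.D_single_eq_zero b hb, map_zero, sub_zero]
              refine ⟨this, ?_, hψε _⟩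
              rw [hb] at this
              exact G.D_eq_zero_of_mem_cell this
            · have hd := F.D_single_mem b hb
              have hc : s (F.D (Pi.single b 1)) ∈ G.cell (m + 1) (F.deg b) :=
                map_mem_of_single_mem hd _ _ fun a ha => by
                  have := hs a
                  rw [ha.1] at this
                  exact G.cell_mono ha.2 this
              refine ⟨sub_mem (hψ b) (by rw [hb]; exact hc), ?_, ?_⟩
              · have : ψ (F.D (Pi.single b 1)) =
                    G.D (s (F.D (Pi.single b 1))) + s (F.D (F.D (Pi.single b 1))) :=
                  map_eq_of_single_eq hd ψ (G.D ∘ₗ s + s ∘ₗ F.D) fun a ha =>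
                    hsn a (by have := ha.1; omega)
                rw [F.D_D, map_zero, add_zero] at this
                rw [map_sub, ← hψD, this, sub_self]
              · rw [map_sub, hψε, G.ε_eq_zero_of_mem_cell hc, sub_zero]
          obtain ⟨y, hy, hyD⟩ := G.exact_cell hc h0 h1
          exact ⟨y, hy, fun h => absurd hb h, fun _ => by rw [hyD]; abel⟩
        · exact ⟨s (Pi.single b 1), hs b, fun _ => rfl, fun h => absurd h hb⟩
      choose y hyc hyne hyeq using hy
      obtain ⟨s', hs'⟩ := exists_linearMap_single (K := K) y
      refine ⟨s', fun b => by rw [hs']; exact hyc b, fun b hb => ?_⟩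
      have hsD : s' (F.D (Pi.single b 1)) = s (F.D (Pi.single b 1)) := by
        refine map_eq_of_single_eq (s := {a | F.lev a ≠ n}) (fun a ha => ?_) s' s fun a ha => ?_
        · have := (F.D_single _ _ ha).1
          change F.lev a ≠ n
          omega
        · rw [hs', hyne a ha]
      rw [hsD, hs']
      by_cases hbn : F.lev b = n
      · exact hyeq b hbn
      · rw [hyne b hbn]
        exact hsn b (by omega)
  obtain ⟨n, hn⟩ := F.exists_lev_lt
  obtain ⟨s, hs, hsn⟩ := key n
  exact ⟨s, hs, fun x => map_eq_of_single_eq (s := Set.univ) (fun _ _ => trivial) ψ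
    (G.D ∘ₗ s + s ∘ₗ F.D) fun b _ => hsn b (hn b)⟩

/-- Every pair of a homological degree and a degree that occurs in a minimal resolution occurs in
every resolution. The composite of comparison maps `F → G → F` is homotopic to the identity, and
`D s + s D` strictly lowers degrees since `F` is minimal; so `b` occurs in the image of its own
image, which has to involve a basis element of `G` of the same degrees. -/
theorem exists_lev_eq_deg_eq_of_minimal (hF : F.Minimal) (G : PosetResolution K U) (b : F.B) :
    ∃ c : G.B, G.lev c = F.lev b ∧ G.deg c = F.deg b := by
  obtain ⟨f, hf, hfD, hfε⟩ := F.exists_lift G subset_rfl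
  obtain ⟨g, hg, hgD, hgε⟩ := G.exists_lift F subset_rfl
  obtain ⟨s, hs, hsD⟩ := F.exists_homotopy F (LinearMap.id - g ∘ₗ f)
    (fun b => by
      refine sub_mem (F.single_mem_cell b) ?_
      refine map_mem_of_single_mem (hf b) g _ fun c hc => ?_
      have := hg c
      rw [hc.1] at this
      exact F.cell_mono hc.2 this)
    (fun x => by simp [hfD, hgD]) (fun x => by simp [hfε, hgε])
  have h1 : F.D (s (Pi.single b 1)) b = 0 := by
    have : F.D (s (Pi.single b 1)) ∈ suppIn K {a | a ≠ b} :=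
      map_mem_of_single_mem (hs b) _ _ fun c hc a ha hab => by
        subst hab
        exact hF _ _ ha (le_antisymm (F.D_single _ _ ha).2 hc.2)
    by_contra h
    exact this b h rfl
  have h2 : s (F.D (Pi.single b 1)) b = 0 := by
    have hd : F.D (Pi.single b 1) ∈ suppIn K {a | F.deg a < F.deg b} := fun a ha =>
      lt_of_le_of_ne (F.D_single _ _ ha).2 (hF _ _ ha)
    have : s (F.D (Pi.single b 1)) ∈ suppIn K {a | a ≠ b} :=
      map_mem_of_single_mem hd _ _ fun c hc a ha hab => by
        subst hab
        exact hc.not_ge (hs c a ha).2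
    by_contra h
    exact this b h rfl
  have h3 : g (f (Pi.single b 1)) b ≠ 0 := by
    have := congrFun (hsD (Pi.single b 1)) b
    simp only [LinearMap.sub_apply, LinearMap.id_apply, LinearMap.comp_apply, Pi.sub_apply,
      Pi.single_eq_same, Pi.add_apply, h1, h2, add_zero] at this
    rw [sub_eq_zero] at this
    rw [← this]
    exact one_ne_zero
  by_contra! hne
  refine h3 ?_
  have : g (f (Pi.single b 1)) ∈ suppIn K {a | a ≠ b} :=
    map_mem_of_single_mem (hf b) _ _ fun c hc a ha hab => by
      subst hab
      exact hne c hc.1 (le_antisymm hc.2 (hg c a ha).2)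
  by_contra h
  exact this b h rfl

end PosetResolution

namespace PosetResolution

variable {K : Type*} [Field K] {P : Type*} [PartialOrder P] {U W : Set P}

/-! ### Basic resolutions and the mapping cone -/

/-- The zero resolution, of the empty upper set. -/
noncomputable def empty (K : Type*) [Field K] (P : Type*) [PartialOrder P] :
    PosetResolution K (∅ : Set P) where
  B := Empty
  lev := Empty.elim
  deg := Empty.elim
  D := 0
  ε := 0
  upper := isUpperSet_empty
  D_single b := b.elim
  ε_single b := b.elim
  D_D := by simp
  ε_D := by simp
  exact τ x _ _ _ := ⟨0, zero_mem _, by ext b; exact b.elim⟩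
  surj τ h := h.elim

/-- The resolution with a single basis element, of a principal upper set. -/
noncomputable def principal (K : Type*) [Field K] {P : Type*} [PartialOrder P] (p : P) :
    PosetResolution K (Set.Ici p) where
  B := Unit
  lev _ := 0
  deg _ := p
  D := 0
  ε := LinearMap.proj ()
  upper := isUpperSet_Ici p
  D_single b a h := by simp at h
  ε_single b _ := ⟨rfl, Set.mem_Ici.2 le_rfl⟩
  D_D := by simp
  ε_D := by simp
  exact τ x _ _ h := ⟨0, zero_mem _, by
    ext b
    simpa using h.symm⟩
  surj τ h := ⟨fun _ => 1, fun b _ => ⟨rfl, h⟩, rfl⟩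

/-- The mapping cone of the lift of `U ∩ W → U ⊕ W` resolves `U ∪ W`, by the exact sequence
`0 → U ∩ W → U ⊕ W → U ∪ W → 0`. -/
theorem exists_union (F : PosetResolution K U) (G : PosetResolution K W)
    (H : PosetResolution K (U ∩ W)) :
    ∃ C : PosetResolution K (U ∪ W), ∀ c, (∃ b, C.lev c = F.lev b ∧ C.deg c = F.deg b) ∨
      (∃ b, C.lev c = G.lev b ∧ C.deg c = G.deg b) ∨
      ∃ b, C.lev c = H.lev b + 1 ∧ C.deg c = H.deg b := by
  obtain ⟨f, hf, hfD, hfε⟩ := H.exists_lift F Set.inter_subset_left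
  obtain ⟨g, hg, hgD, hgε⟩ := H.exists_lift G Set.inter_subset_right
  let pF : (F.B ⊕ G.B ⊕ H.B → K) →ₗ[K] (F.B → K) := LinearMap.funLeft K K Sum.inl
  let pG : (F.B ⊕ G.B ⊕ H.B → K) →ₗ[K] (G.B → K) := LinearMap.funLeft K K (Sum.inr ∘ Sum.inl)
  let pH : (F.B ⊕ G.B ⊕ H.B → K) →ₗ[K] (H.B → K) := LinearMap.funLeft K K (Sum.inr ∘ Sum.inr)
  let D : (F.B ⊕ G.B ⊕ H.B → K) →ₗ[K] (F.B ⊕ G.B ⊕ H.B → K) :=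
    LinearMap.pi (Sum.elim (fun a => LinearMap.proj a ∘ₗ (F.D ∘ₗ pF + f ∘ₗ pH))
      (Sum.elim (fun a => LinearMap.proj a ∘ₗ (G.D ∘ₗ pG - g ∘ₗ pH))
        (fun a => LinearMap.proj a ∘ₗ (- (H.D ∘ₗ pH)))))
  let ε : (F.B ⊕ G.B ⊕ H.B → K) →ₗ[K] K := F.ε ∘ₗ pF + G.ε ∘ₗ pG
  have pFD : ∀ x, pF (D x) = F.D (pF x) + f (pH x) := fun x => rfl
  have pGD : ∀ x, pG (D x) = G.D (pG x) - g (pH x) := fun x => rfl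
  have pHD : ∀ x, pH (D x) = - H.D (pH x) := fun x => rfl
  have hε : ∀ x, ε x = F.ε (pF x) + G.ε (pG x) := fun x => rfl
  have ext3 : ∀ x y, pF x = pF y → pG x = pG y → pH x = pH y → x = y := by
    intro x y h1 h2 h3
    funext c
    rcases c with a | a | a
    · exact congrFun h1 a
    · exact congrFun h2 a
    · exact congrFun h3 a
  have sF : ∀ b, pF (Pi.single b 1) = Sum.elim (fun b => Pi.single b 1) (fun _ => 0) b := by
    intro b
    ext i
    rcases b with b | b | b <;> simp [pF, LinearMap.funLeft, Pi.single_apply]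
  have sG : ∀ b, pG (Pi.single b 1) =
      Sum.elim (fun _ => 0) (Sum.elim (fun b => Pi.single b 1) (fun _ => 0)) b := by
    intro b
    ext i
    rcases b with b | b | b <;> simp [pG, LinearMap.funLeft, Pi.single_apply]
  have sH : ∀ b, pH (Pi.single b 1) =
      Sum.elim (fun _ => 0) (Sum.elim (fun _ => 0) (fun b => Pi.single b 1)) b := by
    intro b
    ext i
    rcases b with b | b | b <;> simp [pH, LinearMap.funLeft, Pi.single_apply]
  let deg : F.B ⊕ G.B ⊕ H.B → P := Sum.elim F.deg (Sum.elim G.deg H.deg)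
  have hfs : ∀ {τ : P} {x : H.B → K}, x ∈ suppIn K {b | H.deg b ≤ τ} →
      f x ∈ suppIn K {b | F.deg b ≤ τ} := fun hx =>
    map_mem_of_single_mem hx _ _ fun b hb a ha => (hf b a ha).2.trans hb
  have hgs : ∀ {τ : P} {x : H.B → K}, x ∈ suppIn K {b | H.deg b ≤ τ} →
      g x ∈ suppIn K {b | G.deg b ≤ τ} := fun hx =>
    map_mem_of_single_mem hx _ _ fun b hb a ha => (hg b a ha).2.trans hb
  refine ⟨
    { B := F.B ⊕ G.B ⊕ H.B
      lev := Sum.elim F.lev (Sum.elim G.lev fun b => H.lev b + 1)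
      deg := deg
      D := D
      ε := ε
      upper := F.upper.union G.upper
      D_single := ?_
      ε_single := ?_
      D_D := ?_
      ε_D := ?_
      exact := ?_
      surj := ?_ }, ?_⟩
  · intro b c h
    rcases c with c | c | c
    · have h' : pF (D (Pi.single b 1)) c ≠ 0 := h
      rw [pFD, sF, sH] at h'
      rcases b with b | b | b
      · exact F.D_single b c (by simpa using h')
      · simp at h'
      · have := hf b c (by simpa using h')
        exact ⟨congrArg (· + 1) this.1, this.2⟩
    · have h' : pG (D (Pi.single b 1)) c ≠ 0 := h
      rw [pGD, sG, sH] at h'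
      rcases b with b | b | b
      · simp at h'
      · exact G.D_single b c (by simpa using h')
      · have := hg b c (by simpa using h')
        exact ⟨congrArg (· + 1) this.1, this.2⟩
    · have h' : pH (D (Pi.single b 1)) c ≠ 0 := h
      rw [pHD, sH] at h'
      rcases b with b | b | b
      · simp at h'
      · simp at h'
      · have := H.D_single b c (by simpa using h')
        exact ⟨congrArg (· + 1) this.1, this.2⟩
  · intro b h
    rw [hε, sF, sG] at h
    rcases b with b | b | b
    · have := F.ε_single b (by simpa using h)
      exact ⟨this.1, Or.inl this.2⟩
    · have := G.ε_single b (by simpa using h)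
      exact ⟨this.1, Or.inr this.2⟩
    · simp at h
  · intro x
    apply ext3
    · simp [pFD, pHD, F.D_D, hfD]
    · simp [pGD, pHD, G.D_D, hgD]
    · simp [pHD, H.D_D]
  · intro x
    simp [hε, pFD, pGD, F.ε_D, G.ε_D, hfε, hgε]
  · intro τ x hx hD hεx
    have hxF : pF x ∈ suppIn K {b | F.deg b ≤ τ} := fun b hb => hx (Sum.inl b) hb
    have hxG : pG x ∈ suppIn K {b | G.deg b ≤ τ} := fun b hb => hx (Sum.inr (Sum.inl b)) hb
    have hxH : pH x ∈ suppIn K {b | H.deg b ≤ τ} := fun b hb => hx (Sum.inr (Sum.inr b)) hb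
    have h1 : F.D (pF x) + f (pH x) = 0 := by rw [← pFD, hD, map_zero]
    have h2 : G.D (pG x) - g (pH x) = 0 := by rw [← pGD, hD, map_zero]
    have h3 : H.D (pH x) = 0 := by
      have := pHD x
      rw [hD, map_zero] at this
      simpa using this.symm
    have h4 : H.ε (pH x) = 0 := by
      have := congrArg F.ε h1
      simpa [F.ε_D, hfε] using this
    rw [hε] at hεx
    obtain ⟨c, hc, hcD⟩ := H.exact τ _ hxH h3 h4
    -- The preimage `c` is corrected by a cycle on which the augmentation has the right value.
    obtain ⟨z, hz, hzD, hzε⟩ : ∃ z ∈ suppIn K {b | H.deg b ≤ τ}, H.D z = 0 ∧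
        H.ε z = F.ε (pF x) + H.ε c := by
      by_cases h0 : F.ε (pF x) + H.ε c = 0
      · exact ⟨0, zero_mem _, map_zero _, by rw [h0, map_zero]⟩
      · have hτ : τ ∈ U ∩ W := by
          by_cases h : H.ε c = 0
          · have hF : F.ε (pF x) ≠ 0 := by simpa [h] using h0
            exact ⟨F.mem_of_ε_ne_zero hxF hF, G.mem_of_ε_ne_zero hxG fun hG =>
              hF (by simpa [hG] using hεx)⟩
          · exact H.mem_of_ε_ne_zero hc h
        obtain ⟨z, hz, hz1⟩ := H.surj τ hτ
        refine ⟨(F.ε (pF x) + H.ε c) • z,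
          Submodule.smul_mem _ _ (suppIn_mono (fun _ hb => hb.2) hz), ?_, by simp [hz1]⟩
        rw [map_smul, H.D_eq_zero_of_mem_cell hz, smul_zero]
    have hcz : H.D (c - z) = pH x := by rw [map_sub, hcD, hzD, sub_zero]
    have hczs : c - z ∈ suppIn K {b | H.deg b ≤ τ} := sub_mem hc hz
    obtain ⟨a, ha, haD⟩ := F.exact τ (pF x + f (c - z)) (add_mem hxF (hfs hczs))
      (by rw [map_add, ← hfD, hcz, h1])
      (by rw [map_add, hfε, map_sub, hzε]; ring)
    obtain ⟨b, hb, hbD⟩ := G.exact τ (pG x - g (c - z)) (sub_mem hxG (hgs hczs))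
      (by rw [map_sub, ← hgD, hcz, h2])
      (by rw [map_sub, hgε, map_sub, hzε]; linear_combination hεx)
    refine ⟨Sum.elim a (Sum.elim b (-(c - z))), ?_, ?_⟩
    · rintro (i | i | i) hi
      · exact ha i hi
      · exact hb i hi
      · exact hczs i (neg_ne_zero.1 hi)
    · have eF : pF (Sum.elim a (Sum.elim b (-(c - z)))) = a := rfl
      have eG : pG (Sum.elim a (Sum.elim b (-(c - z)))) = b := rfl
      have eH : pH (Sum.elim a (Sum.elim b (-(c - z)))) = -(c - z) := rfl
      apply ext3
      · rw [pFD, eF, eH, haD, map_neg]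
        abel
      · rw [pGD, eG, eH, hbD, map_neg]
        abel
      · rw [pHD, eH, map_neg, hcz, neg_neg]
  · rintro τ (hτ | hτ)
    · obtain ⟨x, hx, hx1⟩ := F.surj τ hτ
      refine ⟨Sum.elim x 0, ?_, ?_⟩
      · rintro (i | i) hi
        · exact hx i hi
        · simp at hi
      · have eF : pF (Sum.elim x 0) = x := rfl
        have eG : pG (Sum.elim x 0) = 0 := rfl
        rw [hε, eF, eG, hx1, map_zero, add_zero]
    · obtain ⟨x, hx, hx1⟩ := G.surj τ hτ
      refine ⟨Sum.elim 0 (Sum.elim x 0), ?_, ?_⟩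
      · rintro (i | i | i) hi
        · simp at hi
        · exact hx i hi
        · simp at hi
      · have eF : pF (Sum.elim 0 (Sum.elim x 0)) = 0 := rfl
        have eG : pG (Sum.elim 0 (Sum.elim x 0)) = x := rfl
        rw [hε, eF, eG, hx1, map_zero, zero_add]
  · rintro (b | b | b)
    · exact Or.inl ⟨b, rfl, rfl⟩
    · exact Or.inr (Or.inl ⟨b, rfl, rfl⟩)
    · exact Or.inr (Or.inr ⟨b, rfl, rfl⟩)

/-! ### Passing to a part of the basis -/

/-- Extension by zero from a subset of a basis. -/
noncomputable def extendZero (K : Type*) [Field K] {B : Type*} (s : Set B) :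
    (s → K) →ₗ[K] (B → K) :=
  Function.ExtendByZero.linearMap K Subtype.val

/-- Restriction to a subset of a basis. -/
def restrictTo (K : Type*) [Field K] {B : Type*} (s : Set B) : (B → K) →ₗ[K] (s → K) :=
  LinearMap.funLeft K K Subtype.val

section

variable {B : Type*} {s : Set B}

@[simp]
theorem extendZero_coe (x : s → K) (b : s) : extendZero K s x b = x b :=
  Subtype.val_injective.extend_apply _ _ _

theorem extendZero_of_notMem (x : s → K) {b : B} (hb : b ∉ s) : extendZero K s x b = 0 :=
  Function.extend_apply' _ _ _ (by rintro ⟨a, rfl⟩; exact hb a.2)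

@[simp]
theorem restrictTo_apply (x : B → K) (b : s) : restrictTo K s x b = x b := rfl

@[simp]
theorem restrictTo_extendZero (x : s → K) : restrictTo K s (extendZero K s x) = x := by
  ext b
  simp

theorem extendZero_restrictTo {x : B → K} (hx : x ∈ suppIn K s) :
    extendZero K s (restrictTo K s x) = x := by
  ext b
  by_cases hb : b ∈ s
  · exact extendZero_coe _ ⟨b, hb⟩
  · rw [extendZero_of_notMem _ hb]
    by_contra h
    exact hb (hx b (Ne.symm h))

theorem extendZero_mem (x : s → K) {t : Set B} (hx : ∀ b : s, x b ≠ 0 → b.1 ∈ t) :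
    extendZero K s x ∈ suppIn K t := by
  intro b hb
  by_cases hbs : b ∈ s
  · exact hx ⟨b, hbs⟩ (by rwa [← extendZero_coe (K := K) x])
  · exact absurd (extendZero_of_notMem x hbs) hb

theorem extendZero_single [DecidableEq B] [DecidableEq s] (b : s) :
    extendZero K s (Pi.single b 1) = Pi.single b.1 1 := by
  ext a
  by_cases ha : a ∈ s
  · lift a to s using ha
    rw [extendZero_coe]
    simp [Pi.single_apply, Subtype.ext_iff]
  · rw [extendZero_of_notMem _ ha, Pi.single_eq_of_ne]
    rintro rfl
    exact ha b.2

end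

/-- Change of the poset. The basis elements with degree in `S` are kept and get new degrees by `e`;
the strand of the result in degree `q` is the old strand in degree `κ q` if `q ∈ N`, and `0`
otherwise. -/
theorem exists_transport (F : PosetResolution K U) {Q : Type*} [PartialOrder Q] (S : Set P)
    (e : P → Q) (N : Set Q) (κ : Q → P)
    (h : ∀ b q, F.deg b ∈ S ∧ e (F.deg b) ≤ q ↔ q ∈ N ∧ F.deg b ≤ κ q)
    (hup : IsUpperSet {q | q ∈ N ∧ κ q ∈ U}) :
    ∃ G : PosetResolution K {q | q ∈ N ∧ κ q ∈ U},
      ∀ c, ∃ b, F.deg b ∈ S ∧ G.lev c = F.lev b ∧ G.deg c = e (F.deg b) := by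
  classical
  let s : Set F.B := {b | F.deg b ∈ S}
  have hs : ∀ b ∈ s, ∀ a, F.deg a ≤ F.deg b → a ∈ s := fun b hb a hab => by
    have := (h b (e (F.deg b))).1 ⟨hb, le_rfl⟩
    exact ((h a (e (F.deg b))).2 ⟨this.1, hab.trans this.2⟩).1
  have hD : ∀ x : s → K, F.D (extendZero K s x) ∈ suppIn K s := fun x =>
    map_mem_of_single_mem (extendZero_mem x (t := s) fun b _ => b.2) _ _
      fun b hb a ha => hs b hb a (F.D_single _ _ ha).2
  have hκ : ∀ q ∈ N, suppIn K {b | F.deg b ≤ κ q} ≤ suppIn K s := fun q hq =>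
    suppIn_mono fun b hb => ((h b q).2 ⟨hq, hb⟩).1
  have hr : ∀ q ∈ N, ∀ x ∈ suppIn K {b | F.deg b ≤ κ q},
      restrictTo K s x ∈ suppIn K {b : s | e (F.deg b) ≤ q} := fun q hq x hx b hb =>
    ((h b q).2 ⟨hq, hx b hb⟩).2
  refine ⟨
    { B := s
      lev := fun b => F.lev b
      deg := fun b => e (F.deg b)
      D := restrictTo K s ∘ₗ F.D ∘ₗ extendZero K s
      ε := F.ε ∘ₗ extendZero K s
      upper := hup
      D_single := ?_
      ε_single := ?_
      D_D := ?_
      ε_D := ?_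
      exact := ?_
      surj := ?_ }, fun c => ⟨c, c.2, rfl, rfl⟩⟩
  · intro b a hba
    simp only [LinearMap.comp_apply, extendZero_single, restrictTo_apply] at hba
    have := F.D_single _ _ hba
    refine ⟨this.1, ?_⟩
    have hb := (h b _).1 ⟨b.2, le_rfl⟩
    exact ((h a _).2 ⟨hb.1, this.2.trans hb.2⟩).2
  · intro b hb
    simp only [LinearMap.comp_apply, extendZero_single] at hb
    have := F.ε_single _ hb
    have hb := (h b _).1 ⟨b.2, le_rfl⟩
    exact ⟨this.1, hb.1, F.upper hb.2 this.2⟩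
  · intro x
    simp [extendZero_restrictTo (hD x), F.D_D]
  · intro x
    simp [extendZero_restrictTo (hD x), F.ε_D]
  · intro q x hx hDx hεx
    by_cases hq : q ∈ N
    · have hx' : extendZero K s x ∈ suppIn K {b | F.deg b ≤ κ q} :=
        extendZero_mem x fun b hb => ((h b q).1 ⟨b.2, hx b hb⟩).2
      have hDx' : F.D (extendZero K s x) = 0 := by
        rw [← extendZero_restrictTo (hD x)]
        simpa using congrArg (extendZero K s) hDx
      obtain ⟨y, hy, hyD⟩ := F.exact _ _ hx' hDx' hεx
      refine ⟨restrictTo K s y, hr q hq y hy, ?_⟩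
      simp [extendZero_restrictTo (hκ q hq hy), hyD]
    · refine ⟨0, zero_mem _, ?_⟩
      rw [map_zero]
      ext b
      by_contra hb
      exact hq ((h b q).1 ⟨b.2, hx b (Ne.symm hb)⟩).1
  · rintro q ⟨hq, hqU⟩
    obtain ⟨x, hx, hx1⟩ := F.surj _ hqU
    have hx' := suppIn_mono (K := K) (fun b hb => hb.2) hx
    refine ⟨restrictTo K s x, fun b hb => ⟨(hx b hb).1, hr q hq x hx' b hb⟩, ?_⟩
    simp [extendZero_restrictTo (hκ q hq hx'), hx1]

/-! ### Minimal resolutions -/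

/-- Gaussian elimination: a nonzero scalar entry between basis elements `a` and `b` of the same
degree allows to divide out the acyclic subcomplex spanned by `b` and `D b`. -/
theorem exists_card_lt_of_not_minimal (F : PosetResolution K U) (hF : ¬ F.Minimal) :
    ∃ G : PosetResolution K U, Fintype.card G.B < Fintype.card F.B ∧
      ∀ c, ∃ b, G.lev c = F.lev b ∧ G.deg c = F.deg b := by
  classical
  simp only [Minimal, not_forall, not_not] at hF
  obtain ⟨a, b, hab, hdeg⟩ := hF
  set u := F.D (Pi.single b 1) with hu
  have hlev : F.lev a + 1 = F.lev b := (F.D_single _ _ hab).1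
  have hus : ∀ c, u c ≠ 0 → F.lev c = F.lev a ∧ F.deg c ≤ F.deg a := fun c hc => by
    have := F.D_single _ _ hc
    exact ⟨by omega, hdeg ▸ this.2⟩
  have hub : u b = 0 := by
    by_contra hb
    have := (hus b hb).1
    omega
  let s : Set F.B := {c | c ≠ a ∧ c ≠ b}
  -- `r x = x - (x_a / u_a) • u` has no coordinate at `a`, and `π` drops the coordinate `b` as well;
  -- its kernel is the subcomplex spanned by `b` and `u = D b`.
  let r : (F.B → K) →ₗ[K] (F.B → K) :=
    LinearMap.id - (u a)⁻¹ • (LinearMap.proj a).smulRight u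
  have hr : ∀ x, r x = x - ((u a)⁻¹ * x a) • u := fun x => by
    simp [r, LinearMap.smulRight_apply, smul_smul]
  let π : (F.B → K) →ₗ[K] (s → K) := restrictTo K s ∘ₗ r
  let j := extendZero K s
  have hjπ : ∀ x, j (π x) = x - ((u a)⁻¹ * x a) • u - x b • Pi.single b 1 := by
    intro x
    ext c
    by_cases hc : c ∈ s
    · have : j (π x) c = π x ⟨c, hc⟩ := extendZero_coe _ ⟨c, hc⟩
      rw [this]
      have hcb : c ≠ b := hc.2
      simp [π, hr, hcb]
    · rw [show j (π x) c = 0 from extendZero_of_notMem _ hc]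
      have hc' : c = a ∨ c = b := by
        by_contra! hne
        exact hc hne
      have hne : a ≠ b := by
        rintro rfl
        omega
      rcases hc' with rfl | rfl
      · simp only [Pi.sub_apply, Pi.smul_apply, smul_eq_mul, Pi.single_eq_of_ne hne, mul_zero,
          sub_zero]
        field_simp
        simp
      · simp [hub]
  have hπj : ∀ x, π (j x) = x := by
    intro x
    ext c
    have : j x a = 0 := extendZero_of_notMem _ fun h => h.1 rfl
    simp [π, hr, this, j]
  have hπu : π u = 0 := by
    ext c
    simp [π, hr, hab]
  have hπb : π (Pi.single b 1) = 0 := by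
    ext c
    have hne : a ≠ b := by
      rintro rfl
      omega
    have hcb : c.1 ≠ b := c.2.2
    simp [π, hr, hne, hcb]
  have hDu : F.D u = 0 := F.D_D _
  have hεu : F.ε u = 0 := F.ε_D _
  have hεb : F.ε (Pi.single b 1) = 0 := F.ε_single_eq_zero b (by omega)
  have hπD : ∀ x, π (F.D (j (π x))) = π (F.D x) := by
    intro x
    simp [hjπ, hDu, ← hu, hπu]
  have hεj : ∀ x, F.ε (j (π x)) = F.ε x := by
    intro x
    simp [hjπ, hεu, hεb]
  have hπs : ∀ {t : Set F.B}, (a ∈ t → ∀ c, u c ≠ 0 → c ∈ t) → ∀ {x : F.B → K},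
      x ∈ suppIn K t → ∀ c : s, π x c ≠ 0 → c.1 ∈ t := by
    intro t ht x hx c hc
    have : r x ∈ suppIn K t := by
      rw [hr]
      refine sub_mem hx ?_
      by_cases hxa : x a = 0
      · simp [hxa]
      · exact Submodule.smul_mem _ _ (ht (hx a hxa))
    exact this c hc
  have hπτ : ∀ {τ : P} {x : F.B → K}, x ∈ suppIn K {c | F.deg c ≤ τ} →
      π x ∈ suppIn K {c : s | F.deg c ≤ τ} := fun hx =>
    hπs (fun hat c hc => (hus c hc).2.trans hat) hx
  refine ⟨
    { B := s
      lev := fun c => F.lev c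
      deg := fun c => F.deg c
      D := π ∘ₗ F.D ∘ₗ j
      ε := F.ε ∘ₗ j
      upper := F.upper
      D_single := ?_
      ε_single := ?_
      D_D := ?_
      ε_D := ?_
      exact := ?_
      surj := ?_ }, ?_, fun c => ⟨c, rfl, rfl⟩⟩
  · intro c d hcd
    simp only [LinearMap.comp_apply, j, extendZero_single] at hcd
    refine hπs (t := {d | F.lev d + 1 = F.lev c ∧ F.deg d ≤ F.deg c})
      (fun hat d hd => ?_) (fun d hd => F.D_single _ _ hd) d hcd
    have := hus d hd
    exact ⟨by rw [this.1]; exact hat.1, this.2.trans hat.2⟩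
  · intro c hc
    simp only [LinearMap.comp_apply, j, extendZero_single] at hc
    exact F.ε_single _ hc
  · intro x
    simp [hπD, F.D_D]
  · intro x
    simp [hεj, F.ε_D]
  · intro τ x hx hDx hεx
    have hjx : j x ∈ suppIn K {c | F.deg c ≤ τ} := extendZero_mem x hx
    -- `D (j x)` lies in the kernel of `π`, hence is a multiple `β • u`, and `β` vanishes unless
    -- `a`, and thus also `b`, is present in the strand.
    have h0 := hjπ (F.D (j x))
    rw [show π (F.D (j x)) = 0 from hDx, map_zero] at h0
    have hα : F.D (j x) b = 0 := by
      have := congrArg F.D h0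
      simp only [map_zero, map_sub, map_smul, F.D_D, hDu, ← hu, smul_zero, sub_zero,
        zero_sub] at this
      have := congrFun this a
      simpa [hab] using this.symm
    set β := (u a)⁻¹ * F.D (j x) a with hβ
    have hDj : F.D (j x) = β • u := by
      rw [hα, zero_smul, sub_zero] at h0
      exact sub_eq_zero.1 h0.symm
    have hmem : β • Pi.single b 1 ∈ suppIn K {c | F.deg c ≤ τ} := by
      by_cases h : β = 0
      · simp [h]
      · refine Submodule.smul_mem _ _ (single_mem_suppIn ?_ 1)
        have : F.D (j x) a ≠ 0 := fun h' => h (by rw [hβ, h', mul_zero])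
        exact hdeg.symm.trans_le (F.D_mem hjx a this)
    obtain ⟨y, hy, hyD⟩ := F.exact τ (j x - β • Pi.single b 1) (sub_mem hjx hmem)
      (by rw [map_sub, map_smul, ← hu, hDj, sub_self])
      (by rw [map_sub, map_smul, hεb, smul_zero, sub_zero]; exact hεx)
    refine ⟨π y, hπτ hy, ?_⟩
    simp only [LinearMap.comp_apply, hπD, hyD, map_sub, map_smul, hπb, hπj, smul_zero, sub_zero]
  · intro τ hτ
    obtain ⟨x, hx, hx1⟩ := F.surj τ hτ
    refine ⟨π x, hπs (fun hat c hc => ?_) hx, ?_⟩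
    · have := hus c hc
      exact ⟨this.1.trans hat.1, this.2.trans hat.2⟩
    · simp [hεj, hx1]
  · exact Fintype.card_subtype_lt (p := fun c => c ∈ s) (x := a) fun h => h.1 rfl

/-- Every resolution can be replaced by a minimal one without introducing new degrees. -/
theorem exists_minimal (F : PosetResolution K U) :
    ∃ G : PosetResolution K U, G.Minimal ∧ ∀ c, ∃ b, G.lev c = F.lev b ∧ G.deg c = F.deg b := by
  induction hn : Fintype.card F.B using Nat.strong_induction_on generalizing F with
  | _ n ih =>
    by_cases hF : F.Minimal
    · exact ⟨F, hF, fun c => ⟨c, rfl, rfl⟩⟩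
    · obtain ⟨G, hGF, hG⟩ := F.exists_card_lt_of_not_minimal hF
      obtain ⟨H, hH, hHG⟩ := ih _ (hn ▸ hGF) G rfl
      refine ⟨H, hH, fun c => ?_⟩
      obtain ⟨b, hb⟩ := hHG c
      obtain ⟨a, ha⟩ := hG b
      exact ⟨a, hb.1.trans ha.1, hb.2.trans ha.2⟩

end PosetResolution

/-! ### Existence of resolutions with prescribed degrees -/

/-- The upper set `U` has a resolution in which only such pairs of a homological degree and a
degree occur that satisfy `Q`. -/
def HasResolution (K : Type*) [Field K] {P : Type*} [PartialOrder P] (U : Set P)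
    (Q : ℕ → P → Prop) : Prop :=
  ∃ F : PosetResolution K U, ∀ b, Q (F.lev b) (F.deg b)

namespace HasResolution

variable {K : Type*} [Field K] {P : Type*} [PartialOrder P] {U W : Set P} {Q : ℕ → P → Prop}

theorem mono {Q' : ℕ → P → Prop} (h : HasResolution K U Q) (hQ : ∀ i p, Q i p → Q' i p) :
    HasResolution K U Q' :=
  let ⟨F, hF⟩ := h
  ⟨F, fun b => hQ _ _ (hF b)⟩

theorem empty : HasResolution K (∅ : Set P) Q :=
  ⟨PosetResolution.empty K P, fun b => b.elim⟩

theorem principal {p : P} (h : Q 0 p) : HasResolution K (Set.Ici p) Q :=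
  ⟨PosetResolution.principal K p, fun _ => h⟩

theorem union (hU : HasResolution K U Q) (hW : HasResolution K W Q)
    (hUW : HasResolution K (U ∩ W) fun i p => Q (i + 1) p) : HasResolution K (U ∪ W) Q := by
  obtain ⟨F, hF⟩ := hU
  obtain ⟨G, hG⟩ := hW
  obtain ⟨H, hH⟩ := hUW
  obtain ⟨C, hC⟩ := F.exists_union G H
  refine ⟨C, fun c => ?_⟩
  rcases hC c with ⟨b, h1, h2⟩ | ⟨b, h1, h2⟩ | ⟨b, h1, h2⟩
  · rw [h1, h2]
    exact hF b
  · rw [h1, h2]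
    exact hG b
  · rw [h1, h2]
    exact hH b

theorem transport {Q' : Type*} [PartialOrder Q'] {R : ℕ → Q' → Prop} (hU : HasResolution K U Q)
    (S : Set P) (e : P → Q') (N : Set Q') (κ : Q' → P)
    (h : ∀ i p q, Q i p → (p ∈ S ∧ e p ≤ q ↔ q ∈ N ∧ p ≤ κ q))
    (hup : IsUpperSet {q | q ∈ N ∧ κ q ∈ U}) (hR : ∀ i p, Q i p → p ∈ S → R i (e p)) :
    HasResolution K {q | q ∈ N ∧ κ q ∈ U} R := by
  obtain ⟨F, hF⟩ := hU
  obtain ⟨G, hG⟩ := F.exists_transport S e N κ (fun b q => h _ _ q (hF b)) hup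
  refine ⟨G, fun c => ?_⟩
  obtain ⟨b, hb, h1, h2⟩ := hG c
  rw [h1, h2]
  exact hR _ _ (hF b) hb

/-- A finitely generated upper set in a join-semilattice has a resolution, with degrees above every
lower bound of the generators. -/
theorem of_finset {P : Type*} [SemilatticeSup P] (p₀ : P) (A : Finset P) (hA : ∀ m ∈ A, p₀ ≤ m) :
    HasResolution K {τ : P | ∃ m ∈ A, m ≤ τ} fun _ p => p₀ ≤ p := by
  classical
  induction hn : A.card using Nat.strong_induction_on generalizing A with
  | _ n ih =>
    induction A using Finset.induction_on with
    | empty =>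
      convert HasResolution.empty (K := K) (P := P)
      simp
    | insert m A hm _ =>
      rw [Finset.card_insert_of_notMem hm] at hn
      have h1 := ih _ (by omega) A (fun x hx => hA x (Finset.mem_insert_of_mem hx)) rfl
      have hmp : p₀ ≤ m := hA m (Finset.mem_insert_self _ _)
      have h2 := ih (A.image (· ⊔ m)).card
        (by have := Finset.card_image_le (s := A) (f := (· ⊔ m)); omega) (A.image (· ⊔ m))
        (fun x hx => by
          obtain ⟨y, -, rfl⟩ := Finset.mem_image.1 hx
          exact hmp.trans le_sup_right) rfl
      convert union h1 (principal (K := K) (p := m) hmp) ?_ using 1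
      · ext τ
        simp [or_comm]
      · convert h2 using 1
        ext τ
        simp only [Set.mem_inter_iff, Set.mem_ofPred_eq, Set.mem_Ici, Finset.mem_image,
          exists_exists_and_eq_and, sup_le_iff]
        tauto

end HasResolution

open MvPolynomial

/-! ### Coefficients at integer exponents -/

section CoeffInt

variable {K : Type*} [Field K] {V : Type*}

/-- An exponent vector with natural number entries, as a degree. -/
noncomputable def castExp (m : V →₀ ℕ) : V →₀ ℤ := m.mapRange Nat.cast Nat.cast_zero

/-- The exponent vector of a degree without negative entries (negative entries become `0`). -/
noncomputable def toExp (τ : V →₀ ℤ) : V →₀ ℕ := τ.mapRange Int.toNat rfl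

@[simp]
theorem castExp_apply (m : V →₀ ℕ) (v : V) : castExp m v = m v := by simp [castExp]

@[simp]
theorem toExp_apply (τ : V →₀ ℤ) (v : V) : toExp τ v = (τ v).toNat := by simp [toExp]

theorem castExp_nonneg (m : V →₀ ℕ) : 0 ≤ castExp m := fun v => by simp

@[simp]
theorem toExp_castExp (m : V →₀ ℕ) : toExp (castExp m) = m := by
  ext v
  simp

theorem castExp_toExp {τ : V →₀ ℤ} (h : 0 ≤ τ) : castExp (toExp τ) = τ := by
  ext v
  simpa using h v

open Classical in
/-- The coefficient of a polynomial at an integer exponent vector, which is `0` if the vector has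
a negative entry. -/
noncomputable def coeffInt (τ : V →₀ ℤ) : MvPolynomial V K →ₗ[K] K :=
  if 0 ≤ τ then lcoeff K (toExp τ) else 0

open Classical in
/-- The monomial `c x^τ`, which is `0` if `τ` has a negative entry. -/
noncomputable def monomialInt (τ : V →₀ ℤ) (c : K) : MvPolynomial V K :=
  if 0 ≤ τ then monomial (toExp τ) c else 0

theorem coeffInt_of_nonneg {τ : V →₀ ℤ} (h : 0 ≤ τ) (p : MvPolynomial V K) :
    coeffInt τ p = coeff (toExp τ) p := by
  simp [coeffInt, h]

theorem coeffInt_castExp (m : V →₀ ℕ) (p : MvPolynomial V K) :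
    coeffInt (castExp m) p = coeff m p := by
  rw [coeffInt_of_nonneg (castExp_nonneg m), toExp_castExp]

theorem nonneg_of_coeffInt_ne_zero {τ : V →₀ ℤ} {p : MvPolynomial V K} (h : coeffInt τ p ≠ 0) :
    0 ≤ τ := by
  by_contra hτ
  exact h (by simp [coeffInt, hτ])

theorem eq_of_coeffInt_eq {p q : MvPolynomial V K} (h : ∀ τ, coeffInt τ p = coeffInt τ q) :
    p = q := by
  ext m
  rw [← coeffInt_castExp, ← coeffInt_castExp, h]

theorem coeffInt_zero (p : MvPolynomial V K) : coeffInt 0 p = constantCoeff p := by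
  rw [coeffInt_of_nonneg le_rfl, constantCoeff_eq]
  congr 1

theorem coeffInt_monomialInt_self {τ : V →₀ ℤ} {c : K} (h : c ≠ 0 → 0 ≤ τ) :
    coeffInt τ (monomialInt τ c) = c := by
  by_cases hτ : 0 ≤ τ
  · classical
    simp [coeffInt_of_nonneg hτ, monomialInt, hτ, coeff_monomial]
  · have : c = 0 := by
      by_contra hc
      exact hτ (h hc)
    simp [this, monomialInt]

theorem coeffInt_monomialInt_of_ne {σ τ : V →₀ ℤ} (c : K) (h : σ ≠ τ) :
    coeffInt σ (monomialInt τ c) = 0 := by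
  by_contra hne
  have hσ := nonneg_of_coeffInt_ne_zero hne
  rw [coeffInt_of_nonneg hσ] at hne
  by_cases hτ : 0 ≤ τ
  · have : toExp τ ≠ toExp σ := fun h' => h (by rw [← castExp_toExp hσ, ← h', castExp_toExp hτ])
    classical
    simp [monomialInt, hτ, coeff_monomial, this] at hne
  · simp [monomialInt, hτ] at hne

theorem weight_fineWeight (m : V →₀ ℕ) : Finsupp.weight (fineWeight V) m = castExp m := by
  ext v
  simp only [Finsupp.weight_apply, fineWeight, Finsupp.sum, Finsupp.finsetSum_apply,
    Finsupp.smul_apply, castExp_apply]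
  classical
  simp only [Finsupp.single_apply, smul_ite, smul_zero, nsmul_eq_mul, mul_one]
  rw [Finset.sum_ite_eq' m.support v]
  simp [eq_comm]

theorem isWeightedHomogeneous_monomialInt (τ : V →₀ ℤ) (c : K) :
    IsWeightedHomogeneous (fineWeight V) (monomialInt τ c) τ := by
  unfold monomialInt
  split_ifs with h
  · refine isWeightedHomogeneous_monomial _ _ _ ?_
    rw [weight_fineWeight, castExp_toExp h]
  · exact isWeightedHomogeneous_zero _ _ _

theorem eq_monomialInt {p : MvPolynomial V K} {σ : V →₀ ℤ}
    (h : IsWeightedHomogeneous (fineWeight V) p σ) : p = monomialInt σ (coeffInt σ p) := by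
  refine eq_of_coeffInt_eq fun τ => ?_
  by_cases hτ : τ = σ
  · subst hτ
    rw [coeffInt_monomialInt_self nonneg_of_coeffInt_ne_zero]
  · rw [coeffInt_monomialInt_of_ne _ hτ]
    by_contra hne
    have h0 := nonneg_of_coeffInt_ne_zero hne
    rw [coeffInt_of_nonneg h0] at hne
    have := h hne
    rw [weight_fineWeight, castExp_toExp h0] at this
    exact hτ this

theorem coeffInt_mul {p q : MvPolynomial V K} {σ : V →₀ ℤ}
    (h : IsWeightedHomogeneous (fineWeight V) q σ) (τ : V →₀ ℤ) :
    coeffInt τ (p * q) = coeffInt σ q * coeffInt (τ - σ) p := by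
  rw [eq_monomialInt h]
  set c := coeffInt σ q
  by_cases hσ : 0 ≤ σ
  · rw [coeffInt_monomialInt_self fun _ => hσ]
    simp only [monomialInt, hσ, if_true]
    by_cases hτ : 0 ≤ τ
    · rw [coeffInt_of_nonneg hτ, coeff_mul_monomial']
      have hle : toExp σ ≤ toExp τ ↔ 0 ≤ τ - σ := by
        rw [sub_nonneg]
        refine forall_congr' fun v => ?_
        have h1 := hσ v
        have h2 := hτ v
        simp only [Finsupp.coe_zero, Pi.zero_apply] at h1 h2
        rw [toExp_apply, toExp_apply]
        omega
      by_cases hle' : 0 ≤ τ - σ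
      · rw [if_pos (hle.2 hle'), coeffInt_of_nonneg hle', mul_comm]
        congr 2
        ext v
        have h1 := hσ v
        simp only [Finsupp.coe_zero, Pi.zero_apply] at h1
        simp only [Finsupp.tsub_apply, toExp_apply, Finsupp.sub_apply]
        omega
      · rw [if_neg (hle.not.2 hle')]
        simp [coeffInt, hle']
    · have : ¬ 0 ≤ τ - σ := fun h' => hτ (hσ.trans (sub_nonneg.1 h'))
      simp [coeffInt, hτ, this]
  · simp [monomialInt, hσ]

end CoeffInt

/-! ### Strands of graded free modules -/

section Strand

variable {K : Type*} [Field K] {V : Type*} {ι κ : Type*}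

/-- The component in degree `τ` of an element of a graded free module with basis elements of degrees
`g`, as a coordinate vector. -/
noncomputable def component (g : ι → V →₀ ℤ) (τ : V →₀ ℤ) :
    (ι → MvPolynomial V K) →ₗ[K] (ι → K) :=
  LinearMap.pi fun b => coeffInt (τ - g b) ∘ₗ LinearMap.proj b

/-- The element of degree `τ` of a graded free module with a given coordinate vector. -/
noncomputable def ofComponent (g : ι → V →₀ ℤ) (τ : V →₀ ℤ) (x : ι → K) : ι → MvPolynomial V K :=
  fun b => monomialInt (τ - g b) (x b)

/-- The matrix of scalars of a homogeneous map of graded free modules. -/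
noncomputable def scalars [Fintype ι] [DecidableEq ι] (g : ι → V →₀ ℤ) (g' : κ → V →₀ ℤ)
    (d : (ι → MvPolynomial V K) →ₗ[MvPolynomial V K] (κ → MvPolynomial V K)) :
    (ι → K) →ₗ[K] (κ → K) :=
  Matrix.mulVecLin (Matrix.of fun a b => coeffInt (g b - g' a) (d (Pi.single b 1) a))

/-- A map of graded free modules that is homogeneous of degree `0`. -/
def IsHomogeneousMap [DecidableEq ι] (g : ι → V →₀ ℤ) (g' : κ → V →₀ ℤ)
    (d : (ι → MvPolynomial V K) →ₗ[MvPolynomial V K] (κ → MvPolynomial V K)) : Prop :=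
  ∀ b a, IsWeightedHomogeneous (fineWeight V) (d (Pi.single b 1) a) (g b - g' a)

theorem component_apply (g : ι → V →₀ ℤ) (τ : V →₀ ℤ) (y : ι → MvPolynomial V K) (b : ι) :
    component g τ y b = coeffInt (τ - g b) (y b) := rfl

theorem scalars_single [Fintype ι] [DecidableEq ι] (g : ι → V →₀ ℤ) (g' : κ → V →₀ ℤ)
    (d : (ι → MvPolynomial V K) →ₗ[MvPolynomial V K] (κ → MvPolynomial V K)) (b : ι) (a : κ) :
    scalars g g' d (Pi.single b 1) a = coeffInt (g b - g' a) (d (Pi.single b 1) a) := by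
  simp [scalars]

theorem component_mem (g : ι → V →₀ ℤ) (τ : V →₀ ℤ) (y : ι → MvPolynomial V K) :
    component g τ y ∈ suppIn K {b | g b ≤ τ} := fun _ hb =>
  sub_nonneg.1 (nonneg_of_coeffInt_ne_zero hb)

theorem component_ofComponent (g : ι → V →₀ ℤ) {τ : V →₀ ℤ} {x : ι → K}
    (hx : x ∈ suppIn K {b | g b ≤ τ}) : component g τ (ofComponent g τ x) = x := by
  ext b
  exact coeffInt_monomialInt_self fun h => sub_nonneg.2 (hx b h)

theorem component_ofComponent_of_ne (g : ι → V →₀ ℤ) {σ τ : V →₀ ℤ} (h : σ ≠ τ) (x : ι → K) :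
    component g σ (ofComponent g τ x) = 0 := by
  ext b
  exact coeffInt_monomialInt_of_ne _ fun h' => h (sub_left_injective h')

theorem eq_of_component_eq (g : ι → V →₀ ℤ) {y z : ι → MvPolynomial V K}
    (h : ∀ τ, component g τ y = component g τ z) : y = z := by
  ext1 b
  refine eq_of_coeffInt_eq fun τ => ?_
  simpa [component_apply] using congrFun (h (τ + g b)) b

theorem component_single [DecidableEq ι] (g : ι → V →₀ ℤ) (b : ι) :
    component g (g b) (Pi.single b 1 : ι → MvPolynomial V K) = Pi.single b 1 := by
  ext a
  rw [component_apply]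
  by_cases h : a = b
  · subst h
    simp [coeffInt_zero]
  · simp [Pi.single_eq_of_ne h]

theorem component_map [Fintype ι] [DecidableEq ι] {g : ι → V →₀ ℤ} {g' : κ → V →₀ ℤ}
    {d : (ι → MvPolynomial V K) →ₗ[MvPolynomial V K] (κ → MvPolynomial V K)}
    (hd : IsHomogeneousMap g g' d) (τ : V →₀ ℤ) (y : ι → MvPolynomial V K) :
    component g' τ (d y) = scalars g g' d (component g τ y) := by
  ext a
  have hdy : d y a = ∑ b, y b * d (Pi.single b 1) a := by
    rw [d.pi_apply_eq_sum_univ y, Finset.sum_apply]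
    refine Finset.sum_congr rfl fun b _ => ?_
    rw [Pi.smul_apply, smul_eq_mul]
    have : (fun j => if b = j then 1 else 0) = (Pi.single b 1 : ι → MvPolynomial V K) := by
      funext c
      simp [Pi.single_apply, eq_comm]
    rw [this]
  rw [component_apply, hdy, map_sum]
  simp only [scalars, Matrix.mulVecLin_apply, Matrix.mulVec, dotProduct, Matrix.of_apply]
  refine Finset.sum_congr rfl fun b _ => ?_
  rw [coeffInt_mul (hd b a), component_apply]
  congr 2
  abel_nf

theorem map_eq_zero_of_scalars [Fintype ι] [DecidableEq ι] {g : ι → V →₀ ℤ} {g' : κ → V →₀ ℤ}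
    {d : (ι → MvPolynomial V K) →ₗ[MvPolynomial V K] (κ → MvPolynomial V K)}
    (hd : IsHomogeneousMap g g' d) {τ : V →₀ ℤ} {x : ι → K} (hx : x ∈ suppIn K {b | g b ≤ τ})
    (h : scalars g g' d x = 0) : d (ofComponent g τ x) = 0 := by
  refine eq_of_component_eq g' fun σ => ?_
  rw [component_map hd, map_zero]
  by_cases hσ : σ = τ
  · rw [hσ, component_ofComponent g hx, h]
  · rw [component_ofComponent_of_ne g hσ, map_zero]

theorem finite_component_ne_zero [Fintype ι] (g : ι → V →₀ ℤ) (y : ι → MvPolynomial V K) :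
    {τ | component g τ y ≠ 0}.Finite := by
  refine (Set.finite_iUnion fun b : ι =>
    ((y b).support.finite_toSet.image fun m => castExp m + g b)).subset fun τ hτ => ?_
  obtain ⟨b, hb⟩ := Function.ne_iff.1 hτ
  have h0 := nonneg_of_coeffInt_ne_zero hb
  refine Set.mem_iUnion.2 ⟨b, toExp (τ - g b), ?_, by simp [castExp_toExp h0]⟩
  rw [component_apply, coeffInt_of_nonneg h0] at hb
  exact mem_support_iff.2 hb

/-- An element all of whose components lift lies in the image: only finitely many components are
nonzero, so the lifts can be added. -/
theorem mem_range_of_component [Fintype ι] [DecidableEq ι] [Fintype κ]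
    {g : ι → V →₀ ℤ} {g' : κ → V →₀ ℤ}
    {d : (ι → MvPolynomial V K) →ₗ[MvPolynomial V K] (κ → MvPolynomial V K)}
    (hd : IsHomogeneousMap g g' d) (y : κ → MvPolynomial V K)
    (h : ∀ τ, ∃ z ∈ suppIn K {b | g b ≤ τ}, scalars g g' d z = component g' τ y) :
    ∃ w, d w = y := by
  choose z hz hzy using h
  set T := (finite_component_ne_zero g' y).toFinset
  refine ⟨∑ τ ∈ T, ofComponent g τ (z τ), eq_of_component_eq g' fun σ => ?_⟩
  rw [component_map hd, map_sum]
  by_cases hσ : σ ∈ T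
  · rw [Finset.sum_eq_single_of_mem σ hσ fun τ _ hne => component_ofComponent_of_ne g hne.symm _,
      component_ofComponent g (hz σ), hzy]
  · rw [Finset.sum_eq_zero fun τ hτ => component_ofComponent_of_ne g (fun h' => hσ (by rwa [h'])) _,
      map_zero]
    simpa [T, eq_comm] using hσ

end Strand

variable {K : Type*} [Field K] {V : Type*}

/-! ### From free resolutions to strands -/

/-- `I` is the monomial ideal spanned by the monomials with exponent vector in `U`, an upper set
of vectors with nonnegative entries. -/
structure IsMonomialIdeal (I : Ideal (MvPolynomial V K)) (U : Set (V →₀ ℤ)) : Prop where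
  upper : IsUpperSet U
  nonneg : ∀ τ ∈ U, 0 ≤ τ
  mem_iff : ∀ p, p ∈ I ↔ ∀ τ, coeffInt τ p ≠ 0 → τ ∈ U

theorem IsMonomialIdeal.monomialInt_mem {I : Ideal (MvPolynomial V K)} {U : Set (V →₀ ℤ)}
    (hI : IsMonomialIdeal I U) {τ : V →₀ ℤ} {c : K} (h : c ≠ 0 → τ ∈ U) : monomialInt τ c ∈ I := by
  refine (hI.mem_iff _).2 fun σ hσ => ?_
  by_cases hc : c = 0
  · simp [hc, monomialInt] at hσ
  · by_cases hστ : σ = τ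
    · exact hστ ▸ h hc
    · exact absurd (coeffInt_monomialInt_of_ne c hστ) hσ

namespace MinimalFreeResolution

variable {I : Ideal (MvPolynomial V K)} (F : MinimalFreeResolution I)

/-- The augmentation as a map of graded free modules, with values in the free module `S`. -/
noncomputable def augMap :
    (Fin (F.rank 0) → MvPolynomial V K) →ₗ[MvPolynomial V K] (Unit → MvPolynomial V K) :=
  LinearMap.pi fun _ => I.subtype ∘ₗ F.aug

theorem augMap_apply (y : Fin (F.rank 0) → MvPolynomial V K) (a : Unit) :
    F.augMap y a = F.aug y := rfl

theorem augMap_eq_zero {y : Fin (F.rank 0) → MvPolynomial V K} :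
    F.augMap y = 0 ↔ F.aug y = 0 := by
  refine ⟨fun h => Subtype.ext (congrFun h ()), fun h => ?_⟩
  ext1 a
  rw [augMap_apply, h]
  rfl

theorem isHomogeneousMap_d (i : ℕ) : IsHomogeneousMap (F.deg (i + 1)) (F.deg i) (F.d i) :=
  F.d_homogeneous i

theorem isHomogeneousMap_augMap : IsHomogeneousMap (F.deg 0) (fun _ => 0) F.augMap := fun b a => by
  rw [sub_zero, augMap_apply]
  exact F.aug_homogeneous b

/-- The matrix of scalars of the `i`-th differential. -/
noncomputable def scal (i : ℕ) : (Fin (F.rank (i + 1)) → K) →ₗ[K] (Fin (F.rank i) → K) :=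
  scalars (F.deg (i + 1)) (F.deg i) (F.d i)

/-- The scalars of the augmentation. -/
noncomputable def scalAug : (Fin (F.rank 0) → K) →ₗ[K] K :=
  LinearMap.proj () ∘ₗ scalars (F.deg 0) (fun _ => 0) F.augMap

theorem scal_scal (i : ℕ) (x : Fin (F.rank (i + 1 + 1)) → K) : F.scal i (F.scal (i + 1) x) = 0 := by
  refine map_eq_zero_of_single (s := Set.univ) (fun _ _ => trivial)
    (F.scal i ∘ₗ F.scal (i + 1)) fun b _ => ?_
  rw [LinearMap.comp_apply, ← component_single, scal, scal,
    ← component_map (F.isHomogeneousMap_d _), ← component_map (F.isHomogeneousMap_d _),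
    (F.exact_succ i).apply_apply_eq_zero, map_zero]

theorem scalAug_scal (x : Fin (F.rank 1) → K) : F.scalAug (F.scal 0 x) = 0 := by
  refine map_eq_zero_of_single (s := Set.univ) (fun _ _ => trivial)
    (F.scalAug ∘ₗ F.scal 0) fun b _ => ?_
  rw [LinearMap.comp_apply, ← component_single, scal, scalAug, LinearMap.comp_apply,
    ← component_map (F.isHomogeneousMap_d _), ← component_map F.isHomogeneousMap_augMap,
    F.augMap_eq_zero.2 (F.exact_zero.apply_apply_eq_zero _), map_zero, map_zero]

theorem exists_scal_eq_of_scal_eq_zero {i : ℕ} {τ : V →₀ ℤ} {x : Fin (F.rank (i + 1)) → K}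
    (hx : x ∈ suppIn K {b | F.deg (i + 1) b ≤ τ}) (h : F.scal i x = 0) :
    ∃ y ∈ suppIn K {b | F.deg (i + 1 + 1) b ≤ τ}, F.scal (i + 1) y = x := by
  obtain ⟨w, hw⟩ := (F.exact_succ i _).1 (map_eq_zero_of_scalars (F.isHomogeneousMap_d i) hx h)
  refine ⟨component _ τ w, component_mem _ _ _, ?_⟩
  rw [scal, ← component_map (F.isHomogeneousMap_d _), hw, component_ofComponent _ hx]

theorem exists_scal_eq_of_scalAug_eq_zero {τ : V →₀ ℤ} {x : Fin (F.rank 0) → K}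
    (hx : x ∈ suppIn K {b | F.deg 0 b ≤ τ}) (h : F.scalAug x = 0) :
    ∃ y ∈ suppIn K {b | F.deg 1 b ≤ τ}, F.scal 0 y = x := by
  have h' : scalars (F.deg 0) (fun _ => 0) F.augMap x = 0 := by
    ext a
    exact h
  obtain ⟨w, hw⟩ := (F.exact_zero _).1
    (F.augMap_eq_zero.1 (map_eq_zero_of_scalars F.isHomogeneousMap_augMap hx h'))
  refine ⟨component _ τ w, component_mem _ _ _, ?_⟩
  rw [scal, ← component_map (F.isHomogeneousMap_d _), hw, component_ofComponent _ hx]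

instance finite_basis : Finite (Σ i, Fin (F.rank i)) := by
  obtain ⟨p, hp⟩ := F.finite_length
  have hlt : ∀ c : Σ i, Fin (F.rank i), c.1 < p + 1 := fun c => by
    by_contra h
    have := hp c.1 (by omega)
    exact absurd c.2.2 (by omega)
  refine Finite.of_injective
    (fun c => (⟨⟨c.1, hlt c⟩, c.2⟩ : Σ i : Fin (p + 1), Fin (F.rank i))) ?_
  rintro ⟨i, a⟩ ⟨j, b⟩ h
  simp only [Sigma.mk.injEq, Fin.mk.injEq] at h
  obtain ⟨rfl, h⟩ := h
  simpa using h

/-- The coordinates in homological degree `i`. -/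
def level (i : ℕ) : ((Σ i, Fin (F.rank i)) → K) →ₗ[K] (Fin (F.rank i) → K) :=
  LinearMap.funLeft K K fun b => ⟨i, b⟩

theorem level_apply (i : ℕ) (x : (Σ i, Fin (F.rank i)) → K) (b : Fin (F.rank i)) :
    F.level i x b = x ⟨i, b⟩ := rfl

theorem level_single_self [DecidableEq (Σ i, Fin (F.rank i))] (i : ℕ) (b : Fin (F.rank i)) :
    F.level i (Pi.single ⟨i, b⟩ 1) = Pi.single b 1 := by
  ext a
  simp [level_apply, Pi.single_apply]

theorem level_single_of_ne [DecidableEq (Σ i, Fin (F.rank i))] {i j : ℕ} (h : j ≠ i)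
    (b : Fin (F.rank i)) : F.level j (Pi.single ⟨i, b⟩ 1) = 0 := by
  ext a
  simp [level_apply, h]

/-- The strands of a minimal free resolution of a monomial ideal form a minimal resolution over
the poset of degrees. -/
theorem exists_posetResolution {U : Set (V →₀ ℤ)} (hI : IsMonomialIdeal I U) :
    ∃ G : PosetResolution K U, G.Minimal ∧
      (∀ c, ∃ i b, G.lev c = i ∧ G.deg c = F.deg i b) ∧
      ∀ i b, ∃ c, G.lev c = i ∧ G.deg c = F.deg i b := by
  classical
  let D : ((Σ i, Fin (F.rank i)) → K) →ₗ[K] ((Σ i, Fin (F.rank i)) → K) :=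
    LinearMap.pi fun c => LinearMap.proj c.2 ∘ₗ F.scal c.1 ∘ₗ F.level (c.1 + 1)
  have hD : ∀ i x, F.level i (D x) = F.scal i (F.level (i + 1) x) := fun i x => rfl
  have hlev : ∀ x y, (∀ i, F.level i x = F.level i y) → x = y := fun x y h =>
    funext fun c => congrFun (h c.1) c.2
  have hD1 : ∀ b a, D (Pi.single b 1) a ≠ 0 → a.1 + 1 = b.1 := by
    rintro ⟨j, b⟩ ⟨i, a⟩ h
    by_contra hij
    have h' : F.level i (D (Pi.single ⟨j, b⟩ 1)) a ≠ 0 := h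
    rw [hD, F.level_single_of_ne hij, map_zero] at h'
    exact h' rfl
  have hD2 : ∀ i b a, D (Pi.single ⟨i + 1, b⟩ 1) ⟨i, a⟩ =
      coeffInt (F.deg (i + 1) b - F.deg i a) (F.d i (Pi.single b 1) a) := by
    intro i b a
    have : F.level i (D (Pi.single ⟨i + 1, b⟩ 1)) a = D (Pi.single ⟨i + 1, b⟩ 1) ⟨i, a⟩ := rfl
    rw [← this, hD, F.level_single_self, scal, scalars_single]
  refine ⟨
    { B := Σ i, Fin (F.rank i)
      fintype := Fintype.ofFinite _
      lev := Sigma.fst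
      deg := fun c => F.deg c.1 c.2
      D := D
      ε := F.scalAug ∘ₗ F.level 0
      upper := hI.upper
      D_single := ?_
      ε_single := ?_
      D_D := ?_
      ε_D := ?_
      exact := ?_
      surj := ?_ }, ?_, fun c => ⟨c.1, c.2, rfl, rfl⟩, fun i b => ⟨⟨i, b⟩, rfl, rfl⟩⟩
  · rintro ⟨j, b⟩ ⟨i, a⟩ h
    obtain rfl : i + 1 = j := hD1 _ _ h
    rw [hD2] at h
    exact ⟨rfl, sub_nonneg.1 (nonneg_of_coeffInt_ne_zero h)⟩
  · rintro ⟨j, b⟩ h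
    obtain rfl : 0 = j := by
      by_contra hj
      rw [LinearMap.comp_apply, F.level_single_of_ne hj, map_zero] at h
      exact h rfl
    rw [LinearMap.comp_apply, F.level_single_self, scalAug, LinearMap.comp_apply,
      LinearMap.proj_apply, scalars_single, augMap_apply, sub_zero] at h
    exact ⟨rfl, (hI.mem_iff _).1 (F.aug _).2 _ h⟩
  · intro x
    refine hlev _ _ fun i => ?_
    rw [hD, hD, scal_scal, map_zero]
  · intro x
    rw [LinearMap.comp_apply, hD, scalAug_scal]
  · intro τ x hx hDx hεx
    have hx' : ∀ i, F.level i x ∈ suppIn K {b | F.deg i b ≤ τ} := fun i b hb => hx ⟨i, b⟩ hb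
    have hy : ∀ i, ∃ y ∈ suppIn K {b | F.deg (i + 1) b ≤ τ}, F.scal i y = F.level i x := by
      intro i
      cases i with
      | zero => exact F.exists_scal_eq_of_scalAug_eq_zero (hx' 0) hεx
      | succ i =>
        refine F.exists_scal_eq_of_scal_eq_zero (hx' _) ?_
        rw [← hD, hDx, map_zero]
    choose y hy hyx using hy
    let z : ∀ i, Fin (F.rank i) → K := fun i =>
      match i with
      | 0 => 0
      | i + 1 => y i
    refine ⟨fun c => z c.1 c.2, ?_, ?_⟩
    · rintro ⟨_ | i, b⟩ hb
      · exact absurd rfl hb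
      · exact hy i b hb
    · refine hlev _ _ fun i => ?_
      rw [hD, ← hyx]
      rfl
  · intro τ hτ
    obtain ⟨w, hw⟩ := F.aug_surjective ⟨monomialInt τ 1, hI.monomialInt_mem fun _ => hτ⟩
    let z : ∀ i, Fin (F.rank i) → K := fun i =>
      match i with
      | 0 => component (F.deg 0) τ w
      | _ + 1 => 0
    refine ⟨fun c => z c.1 c.2, ?_, ?_⟩
    · rintro ⟨_ | i, b⟩ hb
      · exact ⟨rfl, component_mem _ _ _ b hb⟩
      · exact absurd rfl hb
    · have : F.level 0 (fun c => z c.1 c.2) = component (F.deg 0) τ w := rfl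
      rw [LinearMap.comp_apply, this, scalAug, LinearMap.comp_apply,
        ← component_map F.isHomogeneousMap_augMap, LinearMap.proj_apply, component_apply,
        augMap_apply, hw, sub_zero, coeffInt_monomialInt_self fun _ => hI.nonneg τ hτ]
  · rintro ⟨i, a⟩ ⟨j, b⟩ h hdeg
    obtain rfl : i + 1 = j := hD1 _ _ h
    change D _ _ ≠ 0 at h
    change F.deg i a = F.deg (i + 1) b at hdeg
    rw [hD2, hdeg, sub_self, coeffInt_zero, F.minimal] at h
    exact h rfl

end MinimalFreeResolution

/-! ### From strands to free resolutions -/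

namespace PosetResolution

variable {I : Ideal (MvPolynomial V K)} {U : Set (V →₀ ℤ)} (T : PosetResolution K U)

/-- An enumeration of the basis elements of homological degree `i`. -/
noncomputable def enum (i : ℕ) : Fin (Fintype.card {b // T.lev b = i}) ≃ {b // T.lev b = i} :=
  (Fintype.equivFin _).symm

/-- The degrees of the basis elements of homological degree `i`. -/
noncomputable def enumDeg (i : ℕ) (b : Fin (Fintype.card {b // T.lev b = i})) : V →₀ ℤ :=
  T.deg (T.enum i b)

/-- The coordinates in homological degree `i`. -/
noncomputable def pull (i : ℕ) : (T.B → K) →ₗ[K] (Fin (Fintype.card {b // T.lev b = i}) → K) :=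
  LinearMap.funLeft K K fun b => (T.enum i b).1

/-- The inclusion of the part of homological degree `i`. -/
noncomputable def push (i : ℕ) : (Fin (Fintype.card {b // T.lev b = i}) → K) →ₗ[K] (T.B → K) :=
  Function.ExtendByZero.linearMap K fun b => (T.enum i b).1

theorem enum_injective (i : ℕ) : Function.Injective fun b => (T.enum i b).1 :=
  Subtype.val_injective.comp (T.enum i).injective

theorem exists_enum_eq {i : ℕ} {a : T.B} (h : T.lev a = i) : ∃ b, (T.enum i b).1 = a :=
  ⟨(T.enum i).symm ⟨a, h⟩, by simp⟩

theorem pull_apply (i : ℕ) (x : T.B → K) (b) : T.pull i x b = x (T.enum i b) := rfl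

theorem push_enum (i : ℕ) (x) (b) : T.push i x (T.enum i b).1 = x b :=
  (T.enum_injective i).extend_apply _ _ _

theorem push_of_lev_ne {i : ℕ} (x) {a : T.B} (h : T.lev a ≠ i) : T.push i x a = 0 :=
  Function.extend_apply' _ _ _ (by rintro ⟨b, rfl⟩; exact h (T.enum i b).2)

theorem pull_push (i : ℕ) (x) : T.pull i (T.push i x) = x := by
  ext b
  rw [pull_apply, push_enum]

theorem push_pull {i : ℕ} {x : T.B → K} (hx : x ∈ suppIn K {b | T.lev b = i}) :
    T.push i (T.pull i x) = x := by
  ext a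
  by_cases ha : T.lev a = i
  · obtain ⟨b, rfl⟩ := T.exists_enum_eq ha
    rw [push_enum, pull_apply]
  · rw [push_of_lev_ne _ _ ha]
    by_contra h
    exact ha (hx a (Ne.symm h))

theorem push_single (i : ℕ) (b) : T.push i (Pi.single b 1) = Pi.single (T.enum i b).1 1 := by
  ext a
  by_cases ha : T.lev a = i
  · obtain ⟨c, rfl⟩ := T.exists_enum_eq ha
    rw [push_enum]
    simp [Pi.single_apply, (T.enum_injective i).eq_iff]
  · rw [push_of_lev_ne _ _ ha, Pi.single_eq_of_ne]
    rintro rfl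
    exact ha (T.enum i b).2

theorem push_mem_cell {i : ℕ} {τ : V →₀ ℤ} {x} (hx : x ∈ suppIn K {b | T.enumDeg i b ≤ τ}) :
    T.push i x ∈ T.cell i τ := by
  intro a ha
  have hai : T.lev a = i := by
    by_contra h
    exact ha (T.push_of_lev_ne x h)
  obtain ⟨b, rfl⟩ := T.exists_enum_eq hai
  rw [push_enum] at ha
  exact ⟨hai, hx b ha⟩

theorem pull_mem {i : ℕ} {τ : V →₀ ℤ} {x} (hx : x ∈ T.cell i τ) :
    T.pull i x ∈ suppIn K {b | T.enumDeg i b ≤ τ} := fun _ hb => (hx _ hb).2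

theorem push_pull_cell {i : ℕ} {τ : V →₀ ℤ} {x} (hx : x ∈ T.cell i τ) :
    T.push i (T.pull i x) = x :=
  T.push_pull (suppIn_mono (fun _ hb => hb.1) hx)

theorem push_mem_lev (i : ℕ) (x) : T.push i x ∈ suppIn K {b | T.lev b = i} := fun _ ha => by
  by_contra h
  exact ha (T.push_of_lev_ne x h)

theorem D_push_mem_lev (i : ℕ) (x) : T.D (T.push (i + 1) x) ∈ suppIn K {b | T.lev b = i} :=
  map_mem_of_single_mem (T.push_mem_lev _ x) _ _ fun b hb a ha => by
    have := (T.D_single b a ha).1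
    have hb' : T.lev b = i + 1 := hb
    change T.lev a = i
    omega

/-- The differential of the associated graded free resolution. -/
noncomputable def polyD (i : ℕ) :
    (Fin (Fintype.card {b // T.lev b = i + 1}) → MvPolynomial V K) →ₗ[MvPolynomial V K]
      (Fin (Fintype.card {b // T.lev b = i}) → MvPolynomial V K) :=
  Matrix.mulVecLin (Matrix.of fun a b => monomialInt (T.enumDeg (i + 1) b - T.enumDeg i a)
    (T.D (Pi.single (T.enum (i + 1) b).1 1) (T.enum i a)))

theorem polyD_single (i : ℕ) (b a) : T.polyD i (Pi.single b 1) a =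
    monomialInt (T.enumDeg (i + 1) b - T.enumDeg i a)
      (T.D (Pi.single (T.enum (i + 1) b).1 1) (T.enum i a)) := by
  simp [polyD]

theorem isHomogeneousMap_polyD (i : ℕ) :
    IsHomogeneousMap (T.enumDeg (i + 1)) (T.enumDeg i) (T.polyD i) := fun b a => by
  rw [polyD_single]
  exact isWeightedHomogeneous_monomialInt _ _

theorem scalars_polyD (i : ℕ) (x) :
    scalars (T.enumDeg (i + 1)) (T.enumDeg i) (T.polyD i) x = T.pull i (T.D (T.push (i + 1) x)) := by
  refine map_eq_of_single_eq (s := Set.univ) (fun _ _ => trivial)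
    (scalars (T.enumDeg (i + 1)) (T.enumDeg i) (T.polyD i)) (T.pull i ∘ₗ T.D ∘ₗ T.push (i + 1))
    fun b _ => ?_
  ext a
  rw [scalars_single, polyD_single, coeffInt_monomialInt_self fun h => ?_]
  · simp only [LinearMap.comp_apply, push_single, pull_apply]
  · exact sub_nonneg.2 (T.D_single _ _ h).2

/-- The augmentation of the associated graded free resolution. -/
noncomputable def polyAug (hI : IsMonomialIdeal I U) :
    (Fin (Fintype.card {b // T.lev b = 0}) → MvPolynomial V K) →ₗ[MvPolynomial V K] I :=
  Fintype.linearCombination (MvPolynomial V K) fun b =>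
    (⟨monomialInt (T.enumDeg 0 b) (T.ε (Pi.single (T.enum 0 b).1 1)),
      hI.monomialInt_mem fun h => (T.ε_single _ h).2⟩ : I)

theorem polyAug_single (hI : IsMonomialIdeal I U) (b) :
    (T.polyAug hI (Pi.single b 1) : MvPolynomial V K) =
      monomialInt (T.enumDeg 0 b) (T.ε (Pi.single (T.enum 0 b).1 1)) := by
  rw [polyAug, Fintype.linearCombination_apply_single, one_smul]

/-- The augmentation with values in the free module `S`. -/
noncomputable def polyAugMap (hI : IsMonomialIdeal I U) :
    (Fin (Fintype.card {b // T.lev b = 0}) → MvPolynomial V K) →ₗ[MvPolynomial V K]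
      (Unit → MvPolynomial V K) :=
  LinearMap.pi fun _ => I.subtype ∘ₗ T.polyAug hI

theorem polyAugMap_apply (hI : IsMonomialIdeal I U) (y) (a : Unit) :
    T.polyAugMap hI y a = T.polyAug hI y := rfl

theorem isHomogeneousMap_polyAugMap (hI : IsMonomialIdeal I U) :
    IsHomogeneousMap (T.enumDeg 0) (fun _ => 0) (T.polyAugMap hI) := fun b a => by
  rw [polyAugMap_apply, polyAug_single, sub_zero]
  exact isWeightedHomogeneous_monomialInt _ _

theorem scalars_polyAugMap (hI : IsMonomialIdeal I U) (x) :
    scalars (T.enumDeg 0) (fun _ => 0) (T.polyAugMap hI) x = fun _ => T.ε (T.push 0 x) := by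
  refine map_eq_of_single_eq (s := Set.univ) (fun _ _ => trivial)
    (scalars (T.enumDeg 0) (fun _ => 0) (T.polyAugMap hI))
    (LinearMap.pi fun _ : Unit => T.ε ∘ₗ T.push 0) fun b _ => ?_
  ext a
  have h0 : T.ε (Pi.single (T.enum 0 b).1 1) ≠ 0 → 0 ≤ T.enumDeg 0 b := fun h =>
    hI.nonneg _ (T.ε_single _ h).2
  rw [scalars_single, polyAugMap_apply, polyAug_single, sub_zero, coeffInt_monomialInt_self h0]
  simp [push_single]

theorem polyD_polyD (i : ℕ) (y) : T.polyD i (T.polyD (i + 1) y) = 0 := by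
  refine eq_of_component_eq (T.enumDeg i) fun τ => ?_
  rw [component_map (T.isHomogeneousMap_polyD _), component_map (T.isHomogeneousMap_polyD _),
    scalars_polyD, scalars_polyD, T.push_pull (T.D_push_mem_lev _ _), T.D_D, map_zero, map_zero]

theorem polyAug_polyD (hI : IsMonomialIdeal I U) (y) : T.polyAug hI (T.polyD 0 y) = 0 := by
  have : T.polyAugMap hI (T.polyD 0 y) = 0 := by
    refine eq_of_component_eq (fun _ => 0) fun τ => ?_
    rw [component_map (T.isHomogeneousMap_polyAugMap hI), component_map (T.isHomogeneousMap_polyD _),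
      scalars_polyD, scalars_polyAugMap, T.push_pull (T.D_push_mem_lev _ _), T.ε_D, map_zero]
    rfl
  exact Subtype.ext (congrFun this ())

theorem exists_polyD_eq {i : ℕ} {y}
    (hD : ∀ τ, T.D (T.push i (component (T.enumDeg i) τ y)) = 0)
    (hε : ∀ τ, T.ε (T.push i (component (T.enumDeg i) τ y)) = 0) : ∃ w, T.polyD i w = y := by
  refine mem_range_of_component (T.isHomogeneousMap_polyD i) y fun τ => ?_
  obtain ⟨z, hz, hzD⟩ := T.exact_cell (T.push_mem_cell (component_mem _ τ y)) (hD τ) (hε τ)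
  refine ⟨T.pull (i + 1) z, T.pull_mem hz, ?_⟩
  rw [scalars_polyD, T.push_pull_cell hz, hzD, pull_push]

/-- A minimal resolution over the poset of degrees comes from a minimal free resolution. -/
theorem exists_minimalFreeResolution (hI : IsMonomialIdeal I U) (hT : T.Minimal) :
    ∃ F : MinimalFreeResolution I,
      (∀ i b, ∃ c, T.lev c = i ∧ T.deg c = F.deg i b) ∧
      ∀ c, ∃ i b, T.lev c = i ∧ T.deg c = F.deg i b := by
  refine ⟨
    { rank := fun i => Fintype.card {b // T.lev b = i}
      deg := T.enumDeg
      d := T.polyD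
      aug := T.polyAug hI
      finite_length := ?_
      d_homogeneous := T.isHomogeneousMap_polyD
      aug_homogeneous := ?_
      aug_surjective := ?_
      exact_zero := ?_
      exact_succ := ?_
      minimal := ?_ }, fun i b => ⟨T.enum i b, (T.enum i b).2, rfl⟩, fun c => ?_⟩
  · obtain ⟨n, hn⟩ := T.exists_lev_lt
    refine ⟨n, fun i hi => Fintype.card_eq_zero_iff.2 ⟨fun b => ?_⟩⟩
    have h1 := hn b.1
    have h2 := b.2
    omega
  · intro b
    rw [polyAug_single]
    exact isWeightedHomogeneous_monomialInt _ _
  · intro p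
    have : ∃ w, T.polyAugMap hI w = fun _ => (p : MvPolynomial V K) := by
      refine mem_range_of_component (T.isHomogeneousMap_polyAugMap hI) _ fun τ => ?_
      by_cases hτ : coeffInt τ (p : MvPolynomial V K) = 0
      · refine ⟨0, zero_mem _, ?_⟩
        ext a
        simp [component_apply, hτ]
      · obtain ⟨x, hx, hx1⟩ := T.surj τ ((hI.mem_iff _).1 p.2 τ hτ)
        refine ⟨coeffInt τ (p : MvPolynomial V K) • T.pull 0 x,
          Submodule.smul_mem _ _ (T.pull_mem hx), ?_⟩
        rw [map_smul, scalars_polyAugMap, T.push_pull_cell hx, hx1]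
        ext a
        simp [component_apply]
    obtain ⟨w, hw⟩ := this
    exact ⟨w, Subtype.ext (congrFun hw ())⟩
  · intro y
    constructor
    · intro hy
      refine T.exists_polyD_eq (fun τ => ?_) fun τ => ?_
      · exact T.D_eq_zero_of_mem_cell (T.push_mem_cell (component_mem _ τ y))
      · have h0 : T.polyAugMap hI y = 0 := by
          ext1 a
          rw [polyAugMap_apply, hy]
          rfl
        have := component_map (T.isHomogeneousMap_polyAugMap hI) τ y
        rw [h0, map_zero, scalars_polyAugMap] at this
        exact (congrFun this ()).symm
    · rintro ⟨w, rfl⟩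
      exact T.polyAug_polyD hI w
  · intro i y
    constructor
    · intro hy
      refine T.exists_polyD_eq (fun τ => ?_) fun τ => ?_
      · have := component_map (T.isHomogeneousMap_polyD i) τ y
        rw [hy, map_zero, scalars_polyD] at this
        rw [← T.push_pull (T.D_push_mem_lev i _), ← this, map_zero]
      · exact T.ε_eq_zero_of_mem_cell (T.push_mem_cell (component_mem _ τ y))
    · rintro ⟨w, rfl⟩
      exact T.polyD_polyD i w
  · intro i b a
    rw [polyD_single, ← coeffInt_zero]
    by_cases h : T.enumDeg (i + 1) b - T.enumDeg i a = 0
    · have h0 : T.D (Pi.single (T.enum (i + 1) b).1 1) (T.enum i a) = 0 := by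
        by_contra hne
        exact hT _ _ hne (sub_eq_zero.1 h).symm
      simp [h0, monomialInt]
    · exact coeffInt_monomialInt_of_ne _ (Ne.symm h)
  · obtain ⟨b, hb⟩ := T.exists_enum_eq (rfl : T.lev c = T.lev c)
    exact ⟨T.lev c, b, rfl, congrArg T.deg hb.symm⟩

end PosetResolution

/-! ### Regularity through bounds on resolutions -/

/-- The condition `|σ| - i ≤ r` on a homological degree `i` and a degree `σ`, together with
nonnegativity of `σ`. -/
def DegreeBound (r : ℤ) (i : ℕ) (σ : V →₀ ℤ) : Prop := 0 ≤ σ ∧ Finsupp.degree σ ≤ r + i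

theorem degree_nonneg {σ : V →₀ ℤ} (h : 0 ≤ σ) : 0 ≤ Finsupp.degree σ :=
  Finset.sum_nonneg fun v _ => h v

theorem MinimalFreeResolution.betti_ne_zero_iff {I : Ideal (MvPolynomial V K)}
    (F : MinimalFreeResolution I) (i : ℕ) (σ : V →₀ ℤ) :
    F.betti i σ ≠ 0 ↔ ∃ b, F.deg i b = σ := by
  rw [MinimalFreeResolution.betti, Nat.card_ne_zero, nonempty_subtype]
  exact and_iff_left inferInstance

namespace IsMonomialIdeal

variable {I : Ideal (MvPolynomial V K)} {U : Set (V →₀ ℤ)}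

theorem ne_bot_iff (hI : IsMonomialIdeal I U) : I ≠ ⊥ ↔ U.Nonempty := by
  rw [Submodule.ne_bot_iff]
  constructor
  · rintro ⟨p, hp, hp0⟩
    by_contra hU
    refine hp0 (eq_of_coeffInt_eq fun τ => ?_)
    rw [map_zero]
    by_contra h
    exact hU ⟨τ, (hI.mem_iff p).1 hp τ h⟩
  · rintro ⟨τ, hτ⟩
    refine ⟨monomialInt τ 1, hI.monomialInt_mem fun _ => hτ, fun h => ?_⟩
    have := coeffInt_monomialInt_self (K := K) (c := 1) fun _ => hI.nonneg τ hτ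
    rw [h, map_zero] at this
    exact zero_ne_one this

/-- The regularity is the least `r` for which there is a resolution, minimal or not, that satisfies
the degree bound. -/
theorem isLeast_of_isRegularity (hI : IsMonomialIdeal I U)
    (hU : HasResolution K U fun _ p => 0 ≤ p) (hne : I ≠ ⊥) {r : ℤ} (hr : IsRegularity I r) :
    IsLeast {s | HasResolution K U (DegreeBound s)} r := by
  obtain ⟨h, -⟩ | ⟨-, F, hF, hFr⟩ := hr
  · exact absurd h hne
  obtain ⟨T, hT, hTF, hFT⟩ := F.exists_posetResolution hI
  constructor
  · obtain ⟨G, hG⟩ := hU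
    refine ⟨T, fun c => ⟨?_, ?_⟩⟩
    · obtain ⟨b, -, hb⟩ := T.exists_lev_eq_deg_eq_of_minimal hT G c
      exact hb ▸ hG b
    · obtain ⟨i, b, h1, h2⟩ := hTF c
      have := hFr ⟨i, _, (F.betti_ne_zero_iff i _).2 ⟨b, rfl⟩, rfl⟩
      rw [h1, h2]
      linarith
  · rintro s ⟨G, hG⟩
    obtain ⟨i, σ, hσ, rfl⟩ := hF
    obtain ⟨b, rfl⟩ := (F.betti_ne_zero_iff i σ).1 hσ
    obtain ⟨c, h1, h2⟩ := hFT i b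
    obtain ⟨d, h3, h4⟩ := T.exists_lev_eq_deg_eq_of_minimal hT G c
    have := (hG d).2
    rw [h3, h4, h1, h2] at this
    linarith

theorem existsUnique_isRegularity (hI : IsMonomialIdeal I U)
    (hU : HasResolution K U fun _ p => 0 ≤ p) : ∃! r : ℤ, IsRegularity I r := by
  by_cases hne : I = ⊥
  · refine ⟨1, Or.inl ⟨hne, rfl⟩, ?_⟩
    rintro r (⟨-, rfl⟩ | ⟨h, -⟩)
    · rfl
    · exact absurd hne h
  · refine existsUnique_of_exists_of_unique ?_ fun r s hr hs =>
      (hI.isLeast_of_isRegularity hU hne hr).unique (hI.isLeast_of_isRegularity hU hne hs)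
    obtain ⟨G, -⟩ := hU
    obtain ⟨T, hT, -⟩ := G.exists_minimal
    obtain ⟨F, hFT, hTF⟩ := T.exists_minimalFreeResolution hI hT
    obtain ⟨τ, hτ⟩ := hI.ne_bot_iff.1 hne
    have hB : Nonempty T.B := by
      obtain ⟨x, -, hx⟩ := T.surj τ hτ
      by_contra h
      rw [not_nonempty_iff] at h
      rw [Subsingleton.elim x 0, map_zero] at hx
      exact zero_ne_one hx
    obtain ⟨c, hc⟩ := Finite.exists_max fun c => Finsupp.degree (T.deg c) - (T.lev c : ℤ)
    refine ⟨Finsupp.degree (T.deg c) - (T.lev c : ℤ), Or.inr ⟨hne, F, ?_, ?_⟩⟩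
    · obtain ⟨i, b, rfl, h⟩ := hTF c
      exact ⟨_, _, (F.betti_ne_zero_iff _ _).2 ⟨b, h.symm⟩, rfl⟩
    · rintro x ⟨i, σ, hσ, rfl⟩
      obtain ⟨b, rfl⟩ := (F.betti_ne_zero_iff i σ).1 hσ
      obtain ⟨d, rfl, h⟩ := hFT i b
      rw [← h]
      exact hc d

end IsMonomialIdeal

/-! ### Operations on monomial ideals that control the regularity -/

namespace HasResolution

theorem isUpperSet {P : Type*} [PartialOrder P] {U : Set P} {Q : ℕ → P → Prop}
    (h : HasResolution K U Q) : IsUpperSet U :=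
  let ⟨F, _⟩ := h
  F.upper

variable {U : Set (V →₀ ℤ)} {r : ℤ}

/-- Multiplication of the ideal by the variable `x_v`. -/
theorem shift (h : HasResolution K U (DegreeBound r)) (v : V) :
    HasResolution K {τ | τ - Finsupp.single v 1 ∈ U} (DegreeBound (r + 1)) := by
  have := h.transport (R := DegreeBound (r + 1)) Set.univ (· + Finsupp.single v 1) Set.univ
    (· - Finsupp.single v 1) (fun i p q _ => by simp [le_sub_iff_add_le])
    (fun σ τ hle hσ => ⟨trivial, h.isUpperSet (sub_le_sub_right hle _) hσ.2⟩)
    (fun i p hp _ => by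
      refine ⟨add_nonneg hp.1 (by simp), ?_⟩
      rw [map_add, Finsupp.degree_single]
      linarith [hp.2])
  simpa using this

/-- Passing to the ideal generated by the elements that do not involve the variable `x_v`. -/
theorem erase (h : HasResolution K U (DegreeBound r)) (v : V) :
    HasResolution K {τ | 0 ≤ τ v ∧ τ.erase v ∈ U} (DegreeBound r) := by
  classical
  refine h.transport {p | p v = 0} id {τ | 0 ≤ τ v} (Finsupp.erase v) (fun i p q hp => ?_)
    (fun σ τ hle hσ => ⟨hσ.1.trans (hle v), h.isUpperSet (fun w => ?_) hσ.2⟩)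
    fun i p hp _ => hp
  · constructor
    · rintro ⟨h0, hpq⟩
      have h0' : p v = 0 := h0
      refine ⟨h0' ▸ hpq v, fun w => ?_⟩
      by_cases hw : w = v
      · subst hw
        rw [Finsupp.erase_same, h0']
      · rw [Finsupp.erase_ne hw]
        exact hpq w
    · rintro ⟨h0, hpq⟩
      have hv : p v = 0 := by
        have h1 := hpq v
        rw [Finsupp.erase_same] at h1
        exact le_antisymm h1 (hp.1 v)
      refine ⟨hv, fun w => ?_⟩
      by_cases hw : w = v
      · subst hw
        rw [id, hv]
        exact h0
      · have h1 := hpq w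
        rwa [Finsupp.erase_ne hw] at h1
  · by_cases hw : w = v
    · subst hw
      simp
    · rw [Finsupp.erase_ne hw, Finsupp.erase_ne hw]
      exact hle w

/-- Adding the variable `x_v` to the generators. -/
theorem union_Ici_single (h : HasResolution K U (DegreeBound r)) (hU : ∀ τ ∈ U, 0 ≤ τ)
    (hr : 1 ≤ r) (v : V) :
    HasResolution K (U ∪ Set.Ici (Finsupp.single v 1)) (DegreeBound r) := by
  have h0 : (0 : V →₀ ℤ) ≤ Finsupp.single v 1 := by simp
  -- Modulo `x_v` the ideal `U` can be replaced by its part `W` without `x_v`, and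
  -- `W ∩ (x_v) = x_v W`.
  have hW := h.erase v
  set W : Set (V →₀ ℤ) := {τ | 0 ≤ τ v ∧ τ.erase v ∈ U} with hWdef
  have hsplit : ∀ τ : V →₀ ℤ, τ.erase v + Finsupp.single v (τ v) = τ := fun τ =>
    Finsupp.erase_add_single v τ
  have hWU : W ⊆ U := fun τ hτ => h.isUpperSet (by
    conv_rhs => rw [← hsplit τ]
    exact le_add_of_nonneg_right (by simpa using hτ.1)) hτ.2
  have hsub : ∀ τ : V →₀ ℤ, (τ - Finsupp.single v 1).erase v = τ.erase v := fun τ => by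
    ext w
    by_cases hw : w = v
    · subst hw
      simp
    · simp [Finsupp.erase_ne hw]
  have hle : ∀ τ ∈ U, 1 ≤ τ v → Finsupp.single v 1 ≤ τ := fun τ hτ h1 w => by
    by_cases hw : w = v
    · subst hw
      simpa using h1
    · rw [Finsupp.single_eq_of_ne hw]
      exact hU τ hτ w
  convert hW.union (W := Set.Ici (Finsupp.single v 1)) (principal ⟨h0, ?_⟩) ?_ using 1
  · ext τ
    constructor
    · rintro (hτ | hτ)
      · by_cases h1 : 1 ≤ τ v
        · exact Or.inr (hle τ hτ h1)
        · have hv : τ v = 0 := by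
            have : 0 ≤ τ v := hU τ hτ v
            omega
          refine Or.inl ⟨hv.ge, ?_⟩
          have := hsplit τ
          rw [hv, Finsupp.single_zero, add_zero] at this
          rwa [this]
      · exact Or.inr hτ
    · rintro (hτ | hτ)
      · exact Or.inl (hWU hτ)
      · exact Or.inr hτ
  · rw [Finsupp.degree_single]
    simpa using hr
  · have hI : W ∩ Set.Ici (Finsupp.single v 1) = {τ | τ - Finsupp.single v 1 ∈ W} := by
      ext τ
      constructor
      · rintro ⟨h1, h2⟩
        refine ⟨?_, by rw [hsub]; exact h1.2⟩
        have := h2 v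
        rw [Finsupp.single_eq_same] at this
        simpa using this
      · rintro ⟨h1, h2⟩
        rw [hsub] at h2
        have h1' : 1 ≤ τ v := by simpa using h1
        have hτ : τ ∈ W := ⟨by omega, h2⟩
        exact ⟨hτ, hle τ (hWU hτ) h1'⟩
    rw [hI]
    refine (hW.shift v).mono fun i p hp => ⟨hp.1, ?_⟩
    push_cast
    linarith [hp.2]

/-- Adding several variables to the generators. -/
theorem union_variables (h : HasResolution K U (DegreeBound r)) (hU : ∀ τ ∈ U, 0 ≤ τ)
    (hr : 1 ≤ r) (A : Finset V) :
    HasResolution K {τ | τ ∈ U ∨ ∃ w ∈ A, Finsupp.single w 1 ≤ τ} (DegreeBound r) := by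
  classical
  induction A using Finset.induction_on with
  | empty => simpa using h
  | insert w A _ ih =>
    convert ih.union_Ici_single ?_ hr w using 1
    · ext τ
      simp only [Finset.mem_insert, exists_eq_or_imp]
      constructor
      · rintro (h1 | h1 | h1)
        exacts [Or.inl (Or.inl h1), Or.inr h1, Or.inl (Or.inr h1)]
      · rintro ((h1 | h1) | h1)
        exacts [Or.inl h1, Or.inr (Or.inr h1), Or.inr (Or.inl h1)]
    · rintro τ (hτ | ⟨w, -, hτ⟩)
      · exact hU τ hτ
      · exact le_trans (by simp) hτ

end HasResolution

/-! ### Edge ideals -/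

/-- The exponent vectors of the monomials in the edge ideal. -/
def edgeSet (G : SimpleGraph V) : Set (V →₀ ℤ) :=
  {τ | 0 ≤ τ ∧ ∃ i j, G.Adj i j ∧ 1 ≤ τ i ∧ 1 ≤ τ j}

theorem single_add_single_le_iff {i j : V} (hij : i ≠ j) {τ : V →₀ ℤ} :
    Finsupp.single i 1 + Finsupp.single j 1 ≤ τ ↔ 0 ≤ τ ∧ 1 ≤ τ i ∧ 1 ≤ τ j := by
  classical
  constructor
  · intro h
    refine ⟨le_trans (add_nonneg (by simp) (by simp)) h, ?_, ?_⟩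
    · simpa [Finsupp.single_apply, hij.symm] using h i
    · simpa [Finsupp.single_apply, hij] using h j
  · rintro ⟨h0, hi, hj⟩ w
    by_cases hwi : i = w
    · subst hwi
      simpa [Finsupp.single_apply, hij.symm] using hi
    · by_cases hwj : j = w
      · subst hwj
        simpa [Finsupp.single_apply, hij] using hj
      · simpa [Finsupp.single_apply, hwi, hwj] using h0 w

theorem two_le_degree_of_mem_edgeSet {G : SimpleGraph V} {τ : V →₀ ℤ} (h : τ ∈ edgeSet G) :
    2 ≤ Finsupp.degree τ := by
  obtain ⟨h0, i, j, hij, hi, hj⟩ := h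
  have := degree_nonneg (sub_nonneg.2 ((single_add_single_le_iff hij.ne).2 ⟨h0, hi, hj⟩))
  rw [map_sub, map_add, Finsupp.degree_single, Finsupp.degree_single] at this
  linarith

theorem isMonomialIdeal_edgeIdeal (G : SimpleGraph V) :
    IsMonomialIdeal (edgeIdeal K G) (edgeSet G) where
  upper := by
    rintro σ τ hle ⟨h0, i, j, hij, hi, hj⟩
    exact ⟨h0.trans hle, i, j, hij, hi.trans (hle i), hj.trans (hle j)⟩
  nonneg τ hτ := hτ.1
  mem_iff p := by
    have hgen : edgeIdeal K G = Ideal.span ((fun s => monomial s (1 : K)) ''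
        {s | ∃ i j, G.Adj i j ∧ s = Finsupp.single i 1 + Finsupp.single j 1}) := by
      unfold edgeIdeal
      congr 1
      ext q
      constructor
      · rintro ⟨i, j, hij, rfl⟩
        exact ⟨_, ⟨i, j, hij, rfl⟩, by simp [X, monomial_mul]⟩
      · rintro ⟨_, ⟨i, j, hij, rfl⟩, rfl⟩
        exact ⟨i, j, hij, by simp [X, monomial_mul]⟩
    have hle : ∀ {i j : V} (m : V →₀ ℕ), i ≠ j →
        (Finsupp.single i 1 + Finsupp.single j 1 ≤ m ↔ 1 ≤ castExp m i ∧ 1 ≤ castExp m j) := by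
      intro i j m hij
      have hc : Finsupp.single i 1 + Finsupp.single j 1 ≤ m ↔
          (Finsupp.single i 1 + Finsupp.single j 1 : V →₀ ℤ) ≤ castExp m := by
        classical
        refine forall_congr' fun w => ?_
        simp only [Finsupp.add_apply, Finsupp.single_apply, castExp_apply]
        split_ifs <;> norm_cast
      rw [hc, single_add_single_le_iff hij]
      exact and_iff_right (castExp_nonneg m)
    rw [hgen, mem_ideal_span_monomial_image]
    constructor
    · intro h τ hτ
      have h0 := nonneg_of_coeffInt_ne_zero hτ
      rw [coeffInt_of_nonneg h0] at hτ
      obtain ⟨_, ⟨i, j, hij, rfl⟩, hs⟩ := h _ (mem_support_iff.2 hτ)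
      rw [hle _ hij.ne, castExp_toExp h0] at hs
      exact ⟨h0, i, j, hij, hs⟩
    · intro h m hm
      rw [mem_support_iff, ← coeffInt_castExp] at hm
      obtain ⟨-, i, j, hij, hs⟩ := h _ hm
      exact ⟨_, ⟨i, j, hij, rfl⟩, (hle m hij.ne).2 hs⟩

theorem hasResolution_edgeSet [Finite V] (G : SimpleGraph V) :
    HasResolution K (edgeSet G) fun _ p => 0 ≤ p := by
  classical
  have := Fintype.ofFinite V
  have hA : edgeSet G = {τ | ∃ m ∈ (Finset.univ.filter fun e : V × V => G.Adj e.1 e.2).image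
      (fun e => (Finsupp.single e.1 1 + Finsupp.single e.2 1 : V →₀ ℤ)), m ≤ τ} := by
    ext τ
    simp only [edgeSet, Set.mem_ofPred_eq, Finset.mem_image, Finset.mem_filter, Finset.mem_univ,
      true_and, Prod.exists]
    constructor
    · rintro ⟨h0, i, j, hij, h⟩
      exact ⟨_, ⟨i, j, hij, rfl⟩, (single_add_single_le_iff hij.ne).2 ⟨h0, h⟩⟩
    · rintro ⟨_, ⟨i, j, hij, rfl⟩, h⟩
      have := (single_add_single_le_iff hij.ne).1 h
      exact ⟨this.1, i, j, hij, this.2⟩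
  rw [hA]
  refine HasResolution.of_finset 0 _ fun m hm => ?_
  obtain ⟨e, -, rfl⟩ := Finset.mem_image.1 hm
  exact add_nonneg (by simp) (by simp)

theorem two_le_of_hasResolution {G : SimpleGraph V} {r : ℤ}
    (h : HasResolution K (edgeSet G) (DegreeBound r)) (hne : (edgeSet G).Nonempty) : 2 ≤ r := by
  obtain ⟨F, hF⟩ := h
  obtain ⟨τ, hτ⟩ := hne
  obtain ⟨x, hx, hx1⟩ := F.surj τ hτ
  by_contra hr
  refine one_ne_zero (hx1.symm.trans (map_eq_zero_of_single hx F.ε fun b hb => ?_))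
  by_contra hb'
  have h1 := two_le_degree_of_mem_edgeSet (F.ε_single b hb').2
  have h2 := (hF b).2
  rw [hb.1, Nat.cast_zero] at h2
  omega

/-! ### Deleting a vertex -/

section Delete

variable (G : SimpleGraph V) (v : V)

/-- Extension by zero of a degree on `V \ {v}`. -/
noncomputable def extendDeg (p : ({v}ᶜ : Set V) →₀ ℤ) : V →₀ ℤ := p.mapDomain Subtype.val

/-- Restriction of a degree to `V \ {v}`. -/
noncomputable def restrictDeg (p : V →₀ ℤ) : ({v}ᶜ : Set V) →₀ ℤ :=
  p.comapDomain Subtype.val Subtype.val_injective.injOn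

@[simp]
theorem extendDeg_coe (p : ({v}ᶜ : Set V) →₀ ℤ) (w : ({v}ᶜ : Set V)) :
    extendDeg v p w = p w :=
  Finsupp.mapDomain_apply Subtype.val_injective _ _

@[simp]
theorem extendDeg_self (p : ({v}ᶜ : Set V) →₀ ℤ) : extendDeg v p v = 0 :=
  Finsupp.mapDomain_of_notMem_range _ _ (by simp)

@[simp]
theorem restrictDeg_apply (p : V →₀ ℤ) (w : ({v}ᶜ : Set V)) : restrictDeg v p w = p w := rfl

theorem degree_extendDeg (p : ({v}ᶜ : Set V) →₀ ℤ) :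
    Finsupp.degree (extendDeg v p) = Finsupp.degree p :=
  Finsupp.degree_mapDomain _ _

theorem forall_iff_self_and_compl {p : V → Prop} :
    (∀ w, p w) ↔ p v ∧ ∀ w : ({v}ᶜ : Set V), p w := by
  refine ⟨fun h => ⟨h v, fun w => h w⟩, fun h w => ?_⟩
  by_cases hw : w = v
  · exact hw ▸ h.1
  · exact h.2 ⟨w, hw⟩

theorem le_iff_self_and_compl {σ τ : V →₀ ℤ} :
    σ ≤ τ ↔ σ v ≤ τ v ∧ restrictDeg v σ ≤ restrictDeg v τ :=
  forall_iff_self_and_compl v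

@[simp]
theorem restrictDeg_extendDeg (p : ({v}ᶜ : Set V) →₀ ℤ) :
    restrictDeg v (extendDeg v p) = p := by
  ext w
  simp

theorem restrictDeg_mono {σ τ : V →₀ ℤ} (h : σ ≤ τ) : restrictDeg v σ ≤ restrictDeg v τ :=
  ((le_iff_self_and_compl v).1 h).2

theorem extendDeg_mono {σ τ : ({v}ᶜ : Set V) →₀ ℤ} (h : σ ≤ τ) :
    extendDeg v σ ≤ extendDeg v τ :=
  (le_iff_self_and_compl v).2 (by simpa using h)

theorem extendDeg_restrictDeg {p : V →₀ ℤ} (h : p v = 0) : extendDeg v (restrictDeg v p) = p := by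
  ext w
  revert w
  rw [forall_iff_self_and_compl v]
  simp [h]

theorem extendDeg_mem_edgeSet_iff (τ : ({v}ᶜ : Set V) →₀ ℤ) :
    extendDeg v τ ∈ edgeSet G ↔ τ ∈ edgeSet (G.induce ({v}ᶜ : Set V)) := by
  have h0 : 0 ≤ extendDeg v τ ↔ 0 ≤ τ := by
    rw [le_iff_self_and_compl v, restrictDeg_extendDeg, extendDeg_self]
    exact and_iff_right le_rfl
  refine and_congr h0 ⟨?_, ?_⟩
  · rintro ⟨i, j, hij, hi, hj⟩
    have hne : ∀ w, 1 ≤ extendDeg v τ w → w ≠ v := by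
      rintro w hw rfl
      simp at hw
    refine ⟨⟨i, hne i hi⟩, ⟨j, hne j hj⟩, hij, ?_, ?_⟩
    · rwa [← extendDeg_coe]
    · rwa [← extendDeg_coe]
  · rintro ⟨i, j, hij, hi, hj⟩
    exact ⟨i, j, hij, by rwa [extendDeg_coe], by rwa [extendDeg_coe]⟩

/-- A resolution of the edge ideal of `G` restricts to one of the edge ideal of `G \ v`: the basis
elements whose degree does not involve `v` are kept. -/
theorem HasResolution.edgeSet_induce {G : SimpleGraph V} {r : ℤ}
    (h : HasResolution K (edgeSet G) (DegreeBound r)) :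
    HasResolution K (edgeSet (G.induce ({v}ᶜ : Set V))) (DegreeBound r) := by
  have := h.transport (R := DegreeBound r) {p | p v = 0} (restrictDeg v) Set.univ (extendDeg v)
    (fun i p q hp => by
      rw [le_iff_self_and_compl v (σ := p), restrictDeg_extendDeg, extendDeg_self]
      have : 0 ≤ p v := hp.1 v
      simp [le_antisymm_iff, this])
    (fun σ τ hle hσ => ⟨trivial, h.isUpperSet (extendDeg_mono v hle) hσ.2⟩)
    (fun i p hp hpv => ⟨restrictDeg_mono v hp.1, by
      rw [← degree_extendDeg, extendDeg_restrictDeg v hpv]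
      exact hp.2⟩)
  convert this using 1
  ext τ
  simp [extendDeg_mem_edgeSet_iff]

/-- The exponent vectors of the monomials in the ideal of `K[x_u : u ∈ V]` generated by the edge
ideal of `G \ v`. -/
def deleteSet : Set (V →₀ ℤ) :=
  {τ | 0 ≤ τ v ∧ restrictDeg v τ ∈ edgeSet (G.induce ({v}ᶜ : Set V))}

variable {G}

theorem nonneg_of_mem_deleteSet {τ : V →₀ ℤ} (h : τ ∈ deleteSet G v) : 0 ≤ τ :=
  (le_iff_self_and_compl v).2 ⟨h.1, h.2.1⟩

theorem HasResolution.deleteSet_of_induce {s : ℤ}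
    (h : HasResolution K (edgeSet (G.induce ({v}ᶜ : Set V))) (DegreeBound s)) :
    HasResolution K (deleteSet G v) (DegreeBound s) := by
  refine h.transport Set.univ (extendDeg v) {τ | 0 ≤ τ v} (restrictDeg v) (fun i p q _ => ?_)
    (fun σ τ hle hσ => ⟨hσ.1.trans (hle v), h.isUpperSet (restrictDeg_mono v hle) hσ.2⟩)
    (fun i p hp _ => ⟨?_, ?_⟩)
  · rw [le_iff_self_and_compl v (τ := q)]
    simp
  · refine (le_iff_self_and_compl v).2 ⟨by simp, ?_⟩
    rw [restrictDeg_extendDeg]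
    exact hp.1
  · rw [degree_extendDeg]
    exact hp.2

theorem restrictDeg_sub_single (τ : V →₀ ℤ) :
    restrictDeg v (τ - Finsupp.single v 1) = restrictDeg v τ := by
  ext w
  have hw : w.1 ≠ v := w.2
  simp [Finsupp.single_eq_of_ne hw]

theorem mem_deleteSet_of_sub {τ : V →₀ ℤ} (h : τ - Finsupp.single v 1 ∈ deleteSet G v) :
    τ ∈ deleteSet G v := by
  refine ⟨?_, restrictDeg_sub_single v τ ▸ h.2⟩
  have := h.1
  simp only [Finsupp.sub_apply, Finsupp.single_eq_same] at this
  omega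

theorem sub_mem_deleteSet {τ : V →₀ ℤ} (h : τ ∈ deleteSet G v) (h1 : 1 ≤ τ v) :
    τ - Finsupp.single v 1 ∈ deleteSet G v := by
  refine ⟨?_, (restrictDeg_sub_single v τ).symm ▸ h.2⟩
  simpa using h1

theorem deleteSet_subset_edgeSet : deleteSet G v ⊆ edgeSet G := by
  rintro τ ⟨h0, h1, i, j, hij, hi, hj⟩
  exact ⟨(le_iff_self_and_compl v).2 ⟨h0, h1⟩, i, j, hij, hi, hj⟩

theorem single_le_sub_iff {w : V} (hw : w ≠ v) {τ : V →₀ ℤ} :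
    Finsupp.single w 1 ≤ τ - Finsupp.single v 1 ↔ 0 ≤ τ ∧ 1 ≤ τ v ∧ 1 ≤ τ w := by
  rw [le_sub_iff_add_le, single_add_single_le_iff hw]
  tauto

/-- The decomposition `I(G) = J + x_v L` with `J` generated by `I(G \ v)` and `L = (I(G) : x_v)`
generated by `J` and the neighbours of `v`. Here `J ∩ x_v L = x_v J`, and neither passing from `J`
to `L` nor to `J` itself raises the bound on the regularity. -/
theorem HasResolution.edgeSet_of_induce [Finite V] {s : ℤ} (hs : 1 ≤ s)
    (h : HasResolution K (edgeSet (G.induce ({v}ᶜ : Set V))) (DegreeBound s)) :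
    HasResolution K (edgeSet G) (DegreeBound (s + 1)) := by
  classical
  have := Fintype.ofFinite V
  have hJ := h.deleteSet_of_induce
  set A : Finset V := Finset.univ.filter (G.Adj v) with hA
  have hL := hJ.union_variables (fun τ => nonneg_of_mem_deleteSet v) hs A
  have hJ' : HasResolution K (deleteSet G v) (DegreeBound (s + 1)) :=
    hJ.mono fun i p hp => ⟨hp.1, by linarith [hp.2]⟩
  have hG : edgeSet G = deleteSet G v ∪ {τ | τ - Finsupp.single v 1 ∈
      {τ | τ ∈ deleteSet G v ∨ ∃ w ∈ A, Finsupp.single w 1 ≤ τ}} := by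
    ext τ
    simp only [Set.mem_union, Set.mem_ofPred_eq, hA, Finset.mem_filter, Finset.mem_univ, true_and]
    constructor
    · rintro ⟨h0, i, j, hij, hi, hj⟩
      by_cases hiv : i = v
      · subst hiv
        exact Or.inr (Or.inr ⟨j, hij, (single_le_sub_iff i hij.ne').2 ⟨h0, hi, hj⟩⟩)
      by_cases hjv : j = v
      · subst hjv
        exact Or.inr (Or.inr ⟨i, hij.symm, (single_le_sub_iff j hij.ne).2 ⟨h0, hj, hi⟩⟩)
      · exact Or.inl ⟨h0 v, restrictDeg_mono v h0, ⟨i, hiv⟩, ⟨j, hjv⟩, hij, hi, hj⟩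
    · rintro (hτ | hτ | ⟨w, hw, hτ⟩)
      · exact deleteSet_subset_edgeSet v hτ
      · exact deleteSet_subset_edgeSet v (mem_deleteSet_of_sub v hτ)
      · obtain ⟨h0, hv1, hw1⟩ := (single_le_sub_iff v hw.ne').1 hτ
        exact ⟨h0, v, w, hw, hv1, hw1⟩
  have hI : deleteSet G v ∩ {τ | τ - Finsupp.single v 1 ∈
      {τ | τ ∈ deleteSet G v ∨ ∃ w ∈ A, Finsupp.single w 1 ≤ τ}} =
      {τ | τ - Finsupp.single v 1 ∈ deleteSet G v} := by
    ext τ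
    constructor
    · rintro ⟨hτ, hτ'⟩
      refine sub_mem_deleteSet v hτ ?_
      have h0 : 0 ≤ τ - Finsupp.single v 1 := by
        rcases hτ' with h' | ⟨w, -, h'⟩
        · exact nonneg_of_mem_deleteSet v h'
        · exact le_trans (by simp) h'
      simpa using h0 v
    · intro hτ
      exact ⟨mem_deleteSet_of_sub v hτ, Or.inl hτ⟩
  rw [hG]
  refine hJ'.union (hL.shift v) ?_
  rw [hI]
  refine (hJ.shift v).mono fun i p hp => ⟨hp.1, ?_⟩
  push_cast
  linarith [hp.2]

end Delete

end EdgeIdealReg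

open EdgeIdealReg in
theorem lemma3p2 (K : Type*) [Field K] {V : Type*} [Finite V] (G : SimpleGraph V) (v : V) :
    (∃! r : ℤ, EdgeIdealReg.IsRegularity (EdgeIdealReg.edgeIdeal K G) r) ∧
    (∃! s : ℤ, EdgeIdealReg.IsRegularity
      (EdgeIdealReg.edgeIdeal K (G.induce ({v}ᶜ : Set V))) s) ∧
    ∀ r s : ℤ, EdgeIdealReg.IsRegularity (EdgeIdealReg.edgeIdeal K G) r →
      EdgeIdealReg.IsRegularity (EdgeIdealReg.edgeIdeal K (G.induce ({v}ᶜ : Set V))) s →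
      |r - s| ≤ 1 := by
  have hG := isMonomialIdeal_edgeIdeal (K := K) G
  have hG' := isMonomialIdeal_edgeIdeal (K := K) (G.induce ({v}ᶜ : Set V))
  have hR := hasResolution_edgeSet (K := K) G
  have hR' := hasResolution_edgeSet (K := K) (G.induce ({v}ᶜ : Set V))
  refine ⟨hG.existsUnique_isRegularity hR, hG'.existsUnique_isRegularity hR', fun r s hr hs => ?_⟩
  -- The convention `reg 0 = 1` makes the bounds below valid for graphs without edges as well.
  have hs' : HasResolution K (edgeSet (G.induce ({v}ᶜ : Set V))) (DegreeBound s) ∧ 1 ≤ s ∧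
      (∀ t, 2 ≤ t → HasResolution K (edgeSet (G.induce ({v}ᶜ : Set V))) (DegreeBound t) →
        s ≤ t) := by
    by_cases hne : edgeIdeal K (G.induce ({v}ᶜ : Set V)) = ⊥
    · have hempty : edgeSet (G.induce ({v}ᶜ : Set V)) = ∅ := by
        by_contra h
        exact hG'.ne_bot_iff.2 (Set.nonempty_iff_ne_empty.2 h) hne
      obtain ⟨-, rfl⟩ | ⟨h, -⟩ := hs
      · refine ⟨?_, le_rfl, fun t ht _ => by omega⟩
        rw [hempty]
        exact HasResolution.empty
      · exact absurd hne h
    · have hl := hG'.isLeast_of_isRegularity hR' hne hs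
      have := two_le_of_hasResolution hl.1 (hG'.ne_bot_iff.1 hne)
      exact ⟨hl.1, by omega, fun t _ h => hl.2 h⟩
  obtain ⟨hs1, hs2, hs3⟩ := hs'
  by_cases hne : edgeIdeal K G = ⊥
  · have hempty : ¬ (edgeSet G).Nonempty := fun h => hG.ne_bot_iff.2 h hne
    have hne' : edgeIdeal K (G.induce ({v}ᶜ : Set V)) = ⊥ := by
      by_contra h
      obtain ⟨τ, hτ⟩ := hG'.ne_bot_iff.1 h
      exact hempty ⟨_, (extendDeg_mem_edgeSet_iff G v τ).2 hτ⟩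
    obtain ⟨-, rfl⟩ | ⟨h, -⟩ := hr
    · obtain ⟨-, rfl⟩ | ⟨h, -⟩ := hs
      · simp
      · exact absurd hne' h
    · exact absurd hne h
  · have hl := hG.isLeast_of_isRegularity hR hne hr
    have h2 := two_le_of_hasResolution hl.1 (hG.ne_bot_iff.1 hne)
    have hle : r ≤ s + 1 := hl.2 (HasResolution.edgeSet_of_induce v hs2 hs1)
    have hge : s ≤ r := hs3 r h2 (hl.1.edgeSet_induce v)
    rw [abs_le]
    constructor <;> omega
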